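/- Let $\lambda\ge 0$, $T\in(0,\infty]$, $\mathbb R^+=(0,\infty)$, and let $f:\mathbb R^+\to\mathbb R$ be measurable. Let $\Delta_\lambda=-\frac{d^2}{dx^2}-\frac{2\lambda}{x}\frac{d}{dx}$. For $t,x,y>0$ let $$W_t^\lambda(x,y)=\frac{(xy)^{-\lambda+1/2}}{2t}\,e^{-\frac{x^2+y^2}{4t}}\,I_{\lambda-1/2}\!\left(\frac{xy}{2t}\right),\qquad P_t^\lambda(x,y)=\frac{t}{\sqrt{4\pi}}\int_0^\infty e^{-\frac{t^2}{4u}}\,W_u^\lambda(x,y)\,\frac{du}{u^{3/2}},$$ where $I_\nu$ is the modified Bessel function of the first kind, be the heat and Poisson kernels of $\Delta_\lambda$, and let $$W_t^\lambda f(x)=\int_0^\infty W_t^\lambda(x,y)f(y)\,y^{2\lambda}dy,\qquad P_t^\lambda f(x)=\int_0^\infty P_t^\lambda(x,y)f(y)\,y^{2\lambda}dy$$ be the heat and Poisson integrals of $f$. Put $$\phi_t^\lambda(y)=y^\lambda\Big(\frac{y}{y+1}\Big)^{\lambda}e^{-\frac{y^2}{4t}},\qquad \phi^\lambda(y)=\frac{y^{2\lambda}}{(y^2+1)^{\lambda+1}}.$$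 (Heat.) If $\int_0^\infty\phi_t^\lambda|f|\,dy<\infty$ for every $t\in(0,T)$, then the integral $u(t,x)=W_t^\lambda f(x)$ converges absolutely for all $t\in(0,T)$ and $x>0$; (i) $u\in C^\infty((0,T)\times\mathbb R^+)$ and $u_t=-\Delta_\lambda u$ there; (ii) $\lim_{t\to0^+}u(t,x)=f(x)$ for a.e. $x>0$. (Poisson.) If $\int_0^\infty\phi^\lambda|f|\,dy<\infty$, then the integral $u(t,x)=P_t^\lambda f(x)$ converges absolutely for all $t,x>0$; (i) $u\in C^\infty((0,\infty)\times\mathbb R^+)$ and $u_{tt}=\Delta_\lambda u$ there; (ii) $\lim_{t\to0^+}u(t,x)=f(x)$ for a.e. $x>0$. (Converse.) Let $f\ge0$. If $W_t^\lambda f(x)<\infty$ for some $t\in(0,T)$ and some $x>0$, then $\int_0^\infty\phi_s^\lambda f\,dy<\infty$ for all $s\in(0,t]$; in particular, if for every $t\in(0,T)$ there is $x>0$ with $W_t^\lambda f(x)<\infty$, then $\int_0^\infty\phi_t^\lambda f\,dy<\infty$ for every $t\in(0,T)$. If $P_t^\lambda f(x)<\infty$ for some $t>0$ and some $x>0$,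 then $\int_0^\infty\phi^\lambda f\,dy<\infty$. -/

import Mathlib

open Set Filter Topology MeasureTheory
open scoped ContDiff

noncomputable section

namespace BesselProblem

/-- The modified Bessel function of the first kind `I_ν(z)` (used for `z > 0`, `ν > -1`). -/
def besselI (ν z : ℝ) : ℝ :=
  ∑' k : ℕ, (z / 2) ^ (2 * (k : ℝ) + ν) / ((k.factorial : ℝ) * Real.Gamma ((k : ℝ) + ν + 1))

/-- The Bessel operator `Δ_λ g = -g'' - (2λ/x) g'` on `(0, ∞)`. -/
def besselOp (lam : ℝ) (g : ℝ → ℝ) (x : ℝ) : ℝ :=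
  -iteratedDeriv 2 g x - 2 * lam / x * deriv g x

/-- The Bessel heat kernel `W_t^λ(x, y)`, for `t, x, y > 0`, with respect to `y^{2λ} dy`. -/
def heatKernel (lam t x y : ℝ) : ℝ :=
  (x * y) ^ (-lam + 1 / 2) / (2 * t) * Real.exp (-(x ^ 2 + y ^ 2) / (4 * t)) *
    besselI (lam - 1 / 2) (x * y / (2 * t))

/-- The Bessel Poisson kernel `P_t^λ(x, y)`, for `t, x, y > 0`, with respect to `y^{2λ} dy`,
subordinated to the heat kernel. -/
def poissonKernel (lam t x y : ℝ) : ℝ :=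
  t / Real.sqrt (4 * Real.pi) *
    ∫ u in Ioi (0 : ℝ), Real.exp (-t ^ 2 / (4 * u)) * heatKernel lam u x y / u ^ (3 / 2 : ℝ)

/-- The heat integral `W_t^λ f(x)`. -/
def heatIntegral (lam : ℝ) (f : ℝ → ℝ) (t x : ℝ) : ℝ :=
  ∫ y in Ioi (0 : ℝ), heatKernel lam t x y * f y * y ^ (2 * lam)

/-- The Poisson integral `P_t^λ f(x)`. -/
def poissonIntegral (lam : ℝ) (f : ℝ → ℝ) (t x : ℝ) : ℝ :=
  ∫ y in Ioi (0 : ℝ), poissonKernel lam t x y * f y * y ^ (2 * lam)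

/-- The integrability factor `φ_t^λ` of the heat problem. -/
def heatFactor (lam t y : ℝ) : ℝ :=
  y ^ lam * (y / (y + 1)) ^ lam * Real.exp (-y ^ 2 / (4 * t))

/-- The integrability factor `φ^λ` of the Poisson problem. -/
def poissonFactor (lam y : ℝ) : ℝ :=
  y ^ (2 * lam) / (y ^ 2 + 1) ^ (lam + 1)

/-- `∫_0^∞ φ(y) |f(y)| dy < ∞`. -/
def FiniteAgainst (φ f : ℝ → ℝ) : Prop :=
  (∫⁻ y in Ioi (0 : ℝ), ENNReal.ofReal (φ y * |f y|)) < ⊤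

end BesselProblem

end

/-
By Poisson's integral formula, `I_{λ-1/2}` is, up to a power, the Laplace transform of a probability
measure `μ_λ` on `[-1, 1]`. The heat kernel is therefore an average over `s ∼ μ_λ` of Gaussians in
`x² + y² - 2xys`, and by subordination the Poisson kernel is an average of
`t (t² + x² + y² - 2xys)^{-λ-1}`. Both integrals become two-parameter Laplace transforms, in
`(1/4t, x/2t)` and in `(t² + x², x)` respectively, which are smooth where they converge absolutely;
their derivatives are moments, and the differential equations reduce to the integration by parts
formula of `μ_λ` (together with invariance under dilations in the Poisson case).

The heat kernel is a Poisson mixture of probability densities, so both kernels have total mass one.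
Near `y = x` they are dominated by a Cauchy kernel, and away from `x` by the integrability factor
times a function of `t` that tends to `0`, which gives convergence at every Lebesgue point. For the
converse, the kernels are bounded below by multiples of the integrability factors.
-/

noncomputable section

namespace BesselProblem

open Real

section AngularMeasure

variable {lam : ℝ}

/-- The weight `(1 - s²) ^ (λ - 1)` on `(-1, 1)` of Poisson's integral for `I_{λ - 1/2}`. -/
def angularWeight (lam s : ℝ) : ℝ := (1 - s ^ 2) ^ (lam - 1)

lemma angularWeight_neg (s : ℝ) : angularWeight lam (-s) = angularWeight lam s := by
  rw [angularWeight, neg_sq, angularWeight]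

lemma angularWeight_pos {s : ℝ} (hs : s ∈ Ioo (-1) 1) : 0 < angularWeight lam s :=
  rpow_pos_of_pos (by nlinarith [hs.1, hs.2]) _

lemma angularWeight_nonneg {s : ℝ} (hs : s ∈ Ioc (-1) 1) : 0 ≤ angularWeight lam s :=
  rpow_nonneg (by nlinarith [hs.1, hs.2]) _

lemma measurable_angularWeight (lam : ℝ) : Measurable (angularWeight lam) :=
  Measurable.pow_const (by fun_prop) _

lemma angularWeight_le {s : ℝ} (h0 : 0 ≤ s) (h1 : s ≤ 1) :
    angularWeight lam s ≤ (1 + 2 ^ (lam - 1)) * (1 - s) ^ (lam - 1) := by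
  have hfactor : (1 + s) ^ (lam - 1) ≤ 1 + 2 ^ (lam - 1) := by
    rcases le_total 0 (lam - 1) with hp | hp
    · linarith [rpow_le_rpow (by linarith) (by linarith : 1 + s ≤ 2) hp]
    · linarith [rpow_le_one_of_one_le_of_nonpos (by linarith : 1 ≤ 1 + s) hp,
        rpow_nonneg zero_le_two (lam - 1)]
  have : (0 : ℝ) ≤ (1 - s) ^ (lam - 1) := rpow_nonneg (by linarith) _
  rw [angularWeight, show 1 - s ^ 2 = (1 + s) * (1 - s) by ring,
    mul_rpow (by linarith) (by linarith)]
  gcongr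

lemma intervalIntegrable_angularWeight (hlam : 0 < lam) :
    IntervalIntegrable (angularWeight lam) volume (-1) 1 := by
  have hhalf : IntervalIntegrable (angularWeight lam) volume 0 1 := by
    have hdom := (intervalIntegral.intervalIntegrable_rpow' (a := 1) (b := 0)
      (show -1 < lam - 1 by linarith)).comp_sub_left 1
    rw [sub_self, sub_zero] at hdom
    refine (hdom.const_mul (1 + 2 ^ (lam - 1))).mono_fun
      (measurable_angularWeight lam).aestronglyMeasurable ?_
    filter_upwards [ae_restrict_mem measurableSet_uIoc] with s hs
    rw [uIoc_of_le zero_le_one] at hs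
    rw [norm_of_nonneg (angularWeight_nonneg ⟨by linarith [hs.1], hs.2⟩)]
    exact (angularWeight_le hs.1.le hs.2).trans (le_abs_self _)
  have hreflect := ((IntervalIntegrable.iff_comp_neg).1 hhalf).symm
  simp only [angularWeight_neg, neg_zero] at hreflect
  exact hreflect.trans hhalf

lemma integral_angularWeight_mul_parts (hlam : 0 < lam) {g g' : ℝ → ℝ}
    (hg : ∀ s, HasDerivAt g (g' s) s) (hg' : Continuous g') :
    ∫ s in (-1 : ℝ)..1, angularWeight lam s * ((s ^ 2 - 1) * g' s + 2 * lam * s * g s) = 0 := by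
  have hg₀ : Continuous g := continuous_iff_continuousAt.2 fun s => (hg s).continuousAt
  have hderiv : ∀ s ∈ Ioo (-1 : ℝ) 1, HasDerivAt (fun s => (1 - s ^ 2) ^ lam * g s)
      (-(angularWeight lam s * ((s ^ 2 - 1) * g' s + 2 * lam * s * g s))) s := fun s hs => by
    have hpos : 0 < 1 - s ^ 2 := by nlinarith [hs.1, hs.2]
    have hpow : (1 - s ^ 2) ^ lam = angularWeight lam s * (1 - s ^ 2) := by
      rw [angularWeight, rpow_sub_one hpos.ne']; field_simp
    have hd := ((((hasDerivAt_id s).pow 2).const_sub 1).rpow_const (p := lam)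
      (Or.inl (by simpa using hpos.ne'))).mul (hg s)
    refine hd.congr_deriv ?_
    simp only [id, Pi.pow_apply, hpow]
    rw [angularWeight]
    push_cast
    ring
  have hInt := intervalIntegral.integral_eq_sub_of_hasDerivAt_of_le (by norm_num)
    (((Continuous.rpow_const (by fun_prop) fun _ => Or.inr hlam.le).mul hg₀).continuousOn) hderiv
    ((intervalIntegrable_angularWeight hlam).mul_continuousOn (by fun_prop)).neg
  rw [intervalIntegral.integral_neg] at hInt
  norm_num [zero_rpow hlam.ne'] at hInt
  exact hInt

lemma intervalIntegral_neg_self_eq {g : ℝ → ℝ} {c : ℝ} (hc : 0 ≤ c)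
    (hg : IntervalIntegrable g volume (-c) c) :
    ∫ s in -c..c, g s = (∫ s in (0 : ℝ)..c, g s) + ∫ s in (0 : ℝ)..c, g (-s) := by
  have hmem : (0 : ℝ) ∈ uIcc (-c) c := by rw [uIcc_of_le] <;> grind
  rw [intervalIntegral.integral_comp_neg, neg_zero, add_comm,
    intervalIntegral.integral_add_adjacent_intervals
      (hg.mono_set (uIcc_subset_uIcc left_mem_uIcc hmem))
      (hg.mono_set (uIcc_subset_uIcc hmem right_mem_uIcc))]

lemma integrableOn_rpow_mul_exp_neg_mul {z : ℝ} (hlam : 0 < lam) (hz : 0 < z) :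
    IntegrableOn (fun r : ℝ => r ^ (lam - 1) * exp (-(z * r))) (Ioi 0) := by
  refine not_imp_comm.1 integral_undef ?_
  rw [integral_rpow_mul_exp_neg_mul_Ioi hlam hz]
  have := Gamma_pos_of_pos hlam
  positivity

lemma integral_one_sub_rpow_mul_exp_le {z : ℝ} (hlam : 0 < lam) (hz : 0 < z) :
    IntervalIntegrable (fun s => (1 - s) ^ (lam - 1) * exp (z * s)) volume 0 1 ∧
      ∫ s in (0 : ℝ)..1, (1 - s) ^ (lam - 1) * exp (z * s) ≤
        Gamma lam * (z ^ (-lam) * exp z) := by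
  set γ : ℝ → ℝ := fun r => r ^ (lam - 1) * exp (-(z * r))
  have hγ : IntegrableOn γ (Ioi 0) := integrableOn_rpow_mul_exp_neg_mul hlam hz
  have hreflect : (fun s => (1 - s) ^ (lam - 1) * exp (z * s)) = fun s => exp z * γ (1 - s) := by
    ext s
    rw [mul_left_comm, ← exp_add]
    ring_nf
  have hγ' : IntervalIntegrable γ volume 1 0 :=
    (intervalIntegrable_iff_integrableOn_Ioc_of_le zero_le_one).2
      (hγ.mono_set Ioc_subset_Ioi_self) |>.symm
  rw [hreflect]
  refine ⟨by simpa using (hγ'.comp_sub_left 1).const_mul (exp z), ?_⟩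
  rw [intervalIntegral.integral_const_mul, intervalIntegral.integral_comp_sub_left, sub_self,
    sub_zero, intervalIntegral.integral_of_le zero_le_one]
  calc exp z * ∫ r in Ioc (0 : ℝ) 1, γ r ≤ exp z * ∫ r in Ioi (0 : ℝ), γ r := by
        refine mul_le_mul_of_nonneg_left (setIntegral_mono_set hγ ?_
          (Eventually.of_forall Ioc_subset_Ioi_self)) (exp_nonneg z)
        filter_upwards [ae_restrict_mem measurableSet_Ioi] with r hr
        exact mul_nonneg (rpow_nonneg (le_of_lt hr) _) (exp_nonneg _)
    _ = Gamma lam * (z ^ (-lam) * exp z) := by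
        rw [integral_rpow_mul_exp_neg_mul_Ioi hlam hz, one_div, inv_rpow hz.le, rpow_neg hz.le]
        ring

lemma integral_angularWeight_mul_exp_le {z : ℝ} (hlam : 0 < lam) (hz : 0 < z) :
    ∫ s in (-1 : ℝ)..1, angularWeight lam s * exp (z * s) ≤
      2 * (1 + 2 ^ (lam - 1)) * Gamma lam * (z ^ (-lam) * exp z) := by
  obtain ⟨hdom, hle⟩ := integral_one_sub_rpow_mul_exp_le hlam hz
  have hweight : IntervalIntegrable (angularWeight lam) volume (-1) 1 :=
    intervalIntegrable_angularWeight hlam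
  have hhalf : IntervalIntegrable (angularWeight lam) volume 0 1 :=
    hweight.mono_set (uIcc_subset_uIcc (by rw [uIcc_of_le] <;> norm_num) right_mem_uIcc)
  have hbound : ∀ σ : ℝ, |σ| ≤ 1 →
      ∫ s in (0 : ℝ)..1, angularWeight lam s * exp (z * (σ * s)) ≤
        (1 + 2 ^ (lam - 1)) * (Gamma lam * (z ^ (-lam) * exp z)) := fun σ hσ => by
    calc ∫ s in (0 : ℝ)..1, angularWeight lam s * exp (z * (σ * s))
        ≤ ∫ s in (0 : ℝ)..1, (1 + 2 ^ (lam - 1)) * ((1 - s) ^ (lam - 1) * exp (z * s)) := by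
          refine intervalIntegral.integral_mono_on zero_le_one
            (hhalf.mul_continuousOn (by fun_prop)) (hdom.const_mul _) fun s hs => ?_
          have hexp : exp (z * (σ * s)) ≤ exp (z * s) := by
            gcongr
            exact mul_le_of_le_one_left hs.1 (le_of_abs_le hσ)
          refine le_of_le_of_eq ?_ (mul_assoc _ _ _)
          exact mul_le_mul (angularWeight_le hs.1 hs.2) hexp (exp_nonneg _)
            (mul_nonneg (by positivity) (rpow_nonneg (by linarith [hs.2]) _))
      _ ≤ _ := by rw [intervalIntegral.integral_const_mul]; gcongr
  rw [intervalIntegral_neg_self_eq zero_le_one (hweight.mul_continuousOn (by fun_prop))]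
  simp only [angularWeight_neg]
  have hpos := hbound 1 (by simp)
  have hneg := hbound (-1) (by simp)
  simp only [one_mul, neg_one_mul] at hpos hneg
  linarith

/-- The probability measure `μ_λ` with density proportional to `(1 - s²) ^ (λ - 1)` on `(-1, 1)`,
for which `I_{λ - 1/2}` is a Laplace transform. At `λ = 0` it is the weak limit
`(δ₁ + δ₋₁) / 2`, a value also used for the irrelevant `λ < 0`. -/
def angularMeasure (lam : ℝ) : Measure ℝ :=
  if 0 < lam then
    (volume.restrict (Ioc (-1) 1)).withDensity fun s =>
      ENNReal.ofReal (angularWeight lam s / ∫ r in (-1 : ℝ)..1, angularWeight lam r)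
  else (2⁻¹ : ENNReal) • (Measure.dirac 1 + Measure.dirac (-1))

lemma integral_angularWeight_pos (hlam : 0 < lam) :
    0 < ∫ s in (-1 : ℝ)..1, angularWeight lam s :=
  intervalIntegral.intervalIntegral_pos_of_pos_on (intervalIntegrable_angularWeight hlam)
    (fun _ hs => angularWeight_pos hs) (by norm_num)

lemma integral_angularMeasure_of_pos (hlam : 0 < lam) (g : ℝ → ℝ) :
    ∫ s, g s ∂angularMeasure lam =
      (∫ s in (-1 : ℝ)..1, angularWeight lam s * g s) /
        ∫ s in (-1 : ℝ)..1, angularWeight lam s := by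
  have hM := integral_angularWeight_pos hlam
  rw [angularMeasure, if_pos hlam, integral_withDensity_eq_integral_toReal_smul
    ((measurable_angularWeight lam).div_const _).ennreal_ofReal (by simp),
    ← intervalIntegral.integral_of_le (by norm_num), ← intervalIntegral.integral_div]
  refine intervalIntegral.integral_congr_Ioo_of_le (by norm_num) fun s hs => ?_
  rw [ENNReal.toReal_ofReal (div_nonneg (angularWeight_pos hs).le hM.le), smul_eq_mul]
  ring

lemma integral_angularMeasure_of_nonpos (hlam : lam ≤ 0) (g : ℝ → ℝ) :
    ∫ s, g s ∂angularMeasure lam = (g 1 + g (-1)) / 2 := by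
  rw [angularMeasure, if_neg hlam.not_gt, integral_smul_measure,
    integral_add_measure (integrable_dirac (by simp)) (integrable_dirac (by simp)),
    integral_dirac, integral_dirac, ENNReal.toReal_inv, smul_eq_mul, inv_mul_eq_div]
  rfl

instance isProbabilityMeasure_angularMeasure : IsProbabilityMeasure (angularMeasure lam) := by
  constructor
  rcases lt_or_ge 0 lam with hlam | hlam
  · have hM := integral_angularWeight_pos hlam
    rw [angularMeasure, if_pos hlam, withDensity_apply _ MeasurableSet.univ, Measure.restrict_univ,
      ← ofReal_integral_eq_lintegral_ofReal
        ((intervalIntegrable_angularWeight hlam).1.div_const _),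
      ← intervalIntegral.integral_of_le (by norm_num), intervalIntegral.integral_div,
      div_self hM.ne', ENNReal.ofReal_one]
    filter_upwards [ae_restrict_mem measurableSet_Ioc] with s hs
    exact div_nonneg (angularWeight_nonneg hs) hM.le
  · rw [angularMeasure, if_neg hlam.not_gt]
    simp [ENNReal.inv_two_add_inv_two]

lemma ae_abs_le_one_angularMeasure : ∀ᵐ s ∂angularMeasure lam, |s| ≤ 1 := by
  rw [angularMeasure]
  split_ifs with hlam
  · refine (withDensity_absolutelyContinuous _ _).ae_le ?_
    filter_upwards [ae_restrict_mem measurableSet_Ioc] with s hs using abs_le.2 ⟨hs.1.le, hs.2⟩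
  · refine Measure.ae_smul_measure (ae_add_measure_iff.2 ⟨?_, ?_⟩) _ <;>
      rw [ae_dirac_eq] <;> simp

lemma integrable_angularMeasure_of_continuous {g : ℝ → ℝ} (hg : Continuous g) :
    Integrable g (angularMeasure lam) := by
  obtain ⟨C, hC⟩ := (isCompact_Icc (a := (-1 : ℝ)) (b := 1)).exists_bound_of_continuousOn
    hg.continuousOn
  exact Integrable.of_bound hg.aestronglyMeasurable C
    (ae_abs_le_one_angularMeasure.mono fun s hs => hC s (abs_le.1 hs))

lemma integral_angularMeasure_comp_neg (g : ℝ → ℝ) :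
    ∫ s, g (-s) ∂angularMeasure lam = ∫ s, g s ∂angularMeasure lam := by
  rcases lt_or_ge 0 lam with hlam | hlam
  · have hreflect := intervalIntegral.integral_comp_neg (a := -1) (b := 1)
      fun s => angularWeight lam s * g s
    simp only [angularWeight_neg, neg_neg] at hreflect
    rw [integral_angularMeasure_of_pos hlam, integral_angularMeasure_of_pos hlam, hreflect]
  · rw [integral_angularMeasure_of_nonpos hlam, integral_angularMeasure_of_nonpos hlam, neg_neg,
      add_comm]

lemma integral_angularMeasure_parts (hlam : 0 ≤ lam) {g g' : ℝ → ℝ}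
    (hg : ∀ s, HasDerivAt g (g' s) s) (hg' : Continuous g') :
    ∫ s, ((s ^ 2 - 1) * g' s + 2 * lam * s * g s) ∂angularMeasure lam = 0 := by
  rcases hlam.eq_or_lt with rfl | hlam
  · rw [integral_angularMeasure_of_nonpos le_rfl]; norm_num
  · rw [integral_angularMeasure_of_pos hlam, integral_angularWeight_mul_parts hlam hg hg', zero_div]

lemma integral_exp_angularMeasure_parts (hlam : 0 ≤ lam) (z : ℝ) :
    ∫ s, ((s ^ 2 - 1) * (z * exp (z * s)) + 2 * lam * s * exp (z * s)) ∂angularMeasure lam = 0 :=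
  integral_angularMeasure_parts hlam
    (fun s => by simpa [mul_comm] using ((hasDerivAt_id s).const_mul z).exp) (by fun_prop)

lemma exists_integral_exp_angularMeasure_le (hlam : 0 ≤ lam) :
    ∃ C > 0, ∀ z : ℝ, 0 < z →
      ∫ s, exp (z * s) ∂angularMeasure lam ≤ C * (z ^ (-lam) * exp z) := by
  rcases hlam.eq_or_lt with rfl | hlam
  · refine ⟨1, one_pos, fun z hz => ?_⟩
    rw [integral_angularMeasure_of_nonpos le_rfl, neg_zero, rpow_zero, mul_one, one_mul, one_mul]
    linarith [exp_le_exp.2 (by linarith : z * -1 ≤ z)]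
  · have hM := integral_angularWeight_pos hlam
    have := Gamma_pos_of_pos hlam
    refine ⟨2 * (1 + 2 ^ (lam - 1)) * Gamma lam / ∫ s in (-1 : ℝ)..1, angularWeight lam s,
      by positivity, fun z hz => ?_⟩
    rw [integral_angularMeasure_of_pos hlam, div_mul_eq_mul_div]
    gcongr
    exact integral_angularWeight_mul_exp_le hlam hz

end AngularMeasure

section KernelFormula

variable {lam : ℝ}

lemma integral_pow_add_two_angularMeasure (hlam : 0 ≤ lam) (n : ℕ) :
    (n + 1 + 2 * lam) * ∫ s, s ^ (n + 2) ∂angularMeasure lam =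
      (n + 1) * ∫ s, s ^ n ∂angularMeasure lam := by
  have hparts := integral_angularMeasure_parts hlam (g := fun s => s ^ (n + 1))
    (g' := fun s => (n + 1) * s ^ n) (fun s => by simpa using hasDerivAt_pow (n + 1) s)
    (by fun_prop)
  have hexpand : (fun s : ℝ => (s ^ 2 - 1) * ((n + 1) * s ^ n) + 2 * lam * s * s ^ (n + 1)) =
      fun s => (n + 1 + 2 * lam) * s ^ (n + 2) - (n + 1) * s ^ n := by
    ext s; ring
  rw [hexpand, integral_sub (integrable_angularMeasure_of_continuous (by fun_prop))
    (integrable_angularMeasure_of_continuous (by fun_prop)), integral_const_mul,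
    integral_const_mul] at hparts
  linarith

lemma integral_pow_odd_angularMeasure (k : ℕ) : ∫ s, s ^ (2 * k + 1) ∂angularMeasure lam = 0 := by
  have hneg := integral_angularMeasure_comp_neg (lam := lam) fun s => s ^ (2 * k + 1)
  simp only [Odd.neg_pow ⟨k, rfl⟩, integral_neg] at hneg
  linarith

lemma integral_pow_even_angularMeasure (hlam : 0 ≤ lam) (k : ℕ) :
    (∫ s, s ^ (2 * k) ∂angularMeasure lam) / (2 * k).factorial =
      Gamma (lam + 1 / 2) / (4 ^ k * k.factorial * Gamma (k + lam + 1 / 2)) := by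
  induction k with
  | zero =>
    have : Gamma (lam + 1 / 2) ≠ 0 := (Gamma_pos_of_pos (by linarith)).ne'
    simp only [mul_zero, pow_zero, integral_const, probReal_univ, Nat.factorial_zero, Nat.cast_one,
      Nat.cast_zero, zero_add, one_mul, smul_eq_mul, div_one]
    rw [div_self this]
  | succ k ih =>
    have hpos : (0 : ℝ) < k + lam + 1 / 2 := by positivity
    have hΓ : Gamma ((k + 1 : ℕ) + lam + 1 / 2) =
        (k + lam + 1 / 2) * Gamma (k + lam + 1 / 2) := by
      rw [← Gamma_add_one hpos.ne']; push_cast; ring_nf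
    have hΓ₀ := (Gamma_pos_of_pos hpos).ne'
    have hfact : ((2 * (k + 1)).factorial : ℝ) =
        (2 * k + 2) * (2 * k + 1) * (2 * k).factorial := by
      rw [show 2 * (k + 1) = 2 * k + 1 + 1 by ring, Nat.factorial_succ, Nat.factorial_succ]
      push_cast; ring
    have hmoment : ∫ s, s ^ (2 * (k + 1)) ∂angularMeasure lam =
        (2 * k + 1) * (∫ s, s ^ (2 * k) ∂angularMeasure lam) / (2 * k + 1 + 2 * lam) := by
      have hrec := integral_pow_add_two_angularMeasure hlam (2 * k)
      push_cast at hrec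
      rw [eq_div_iff (by positivity), mul_add_one, mul_comm, hrec]
    rw [div_eq_div_iff (by positivity) (by positivity)] at ih
    rw [hfact, hΓ, hmoment, Nat.factorial_succ, div_eq_div_iff (by positivity) (by positivity),
      div_mul_eq_mul_div, div_eq_iff (by positivity)]
    push_cast
    linear_combination ((2 * k + 1) * (2 * k + 2) * (2 * k + 1 + 2 * lam)) * ih

lemma hasSum_integral_pow_angularMeasure (z : ℝ) :
    HasSum (fun n : ℕ => z ^ n / n.factorial * ∫ s, s ^ n ∂angularMeasure lam)
      (∫ s, exp (z * s) ∂angularMeasure lam) := by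
  have hterm : ∀ n : ℕ, ∫ s, ‖z ^ n / n.factorial * s ^ n‖ ∂angularMeasure lam ≤
      |z| ^ n / n.factorial := fun n => by
    calc ∫ s, ‖z ^ n / n.factorial * s ^ n‖ ∂angularMeasure lam
        ≤ ∫ _, |z| ^ n / n.factorial ∂angularMeasure lam := by
          refine integral_mono_ae (integrable_angularMeasure_of_continuous (by fun_prop))
            (integrable_const _) (ae_abs_le_one_angularMeasure.mono fun s hs => ?_)
          simp only [norm_mul, norm_div, norm_pow, norm_eq_abs, Nat.abs_cast]
          exact mul_le_of_le_one_right (by positivity) (pow_le_one₀ (abs_nonneg _) hs)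
      _ = |z| ^ n / n.factorial := by simp
  have hexp : ∀ s : ℝ, ∑' n : ℕ, z ^ n / n.factorial * s ^ n = exp (z * s) := fun s => by
    simp only [exp_eq_exp_ℝ, NormedSpace.exp_eq_tsum_div, mul_pow, div_mul_eq_mul_div]
  simpa only [hexp, integral_const_mul] using hasSum_integral_of_summable_integral_norm
    (fun n => integrable_angularMeasure_of_continuous (by fun_prop))
    (Summable.of_nonneg_of_le (fun n => integral_nonneg fun s => norm_nonneg _) hterm
      (summable_pow_div_factorial |z|))

lemma hasSum_integral_exp_angularMeasure (hlam : 0 ≤ lam) (z : ℝ) :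
    HasSum (fun k : ℕ => Gamma (lam + 1 / 2) * (z / 2) ^ (2 * k) /
      (k.factorial * Gamma (k + lam + 1 / 2))) (∫ s, exp (z * s) ∂angularMeasure lam) := by
  have hsum := hasSum_integral_pow_angularMeasure (lam := lam) z
  have hinj : Function.Injective (fun k : ℕ => 2 * k) := mul_right_injective₀ two_ne_zero
  rw [← hinj.hasSum_iff] at hsum
  · refine hsum.congr_fun fun k => ?_
    rw [Function.comp_apply, div_mul_comm, integral_pow_even_angularMeasure hlam k, div_pow,
      pow_mul 2 2 k, show (2 : ℝ) ^ 2 = 4 by norm_num]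
    field_simp
  · intro n hn
    rcases Nat.even_or_odd' n with ⟨k, rfl | rfl⟩
    · exact absurd ⟨k, rfl⟩ hn
    · rw [integral_pow_odd_angularMeasure, mul_zero]

lemma besselI_eq_integral_exp (hlam : 0 ≤ lam) {z : ℝ} (hz : 0 < z) :
    besselI (lam - 1 / 2) z =
      (z / 2) ^ (lam - 1 / 2) / Gamma (lam + 1 / 2) * ∫ s, exp (z * s) ∂angularMeasure lam := by
  have : 0 < Gamma (lam + 1 / 2) := Gamma_pos_of_pos (by linarith)
  rw [← (hasSum_integral_exp_angularMeasure hlam z).tsum_eq, ← tsum_mul_left, besselI]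
  congr 1; ext k
  rw [rpow_add (by positivity), show (2 * (k : ℝ)) = ((2 * k : ℕ) : ℝ) by push_cast; ring,
    rpow_natCast, show (k : ℝ) + (lam - 1 / 2) + 1 = k + lam + 1 / 2 by ring]
  field_simp

/-- The normalising constant of the heat kernel written as an average of Gaussians. -/
def heatConst (lam : ℝ) : ℝ := 2 ^ (-(2 * lam)) / Gamma (lam + 1 / 2)

lemma heatConst_pos (hlam : 0 ≤ lam) : 0 < heatConst lam :=
  div_pos (by positivity) (Gamma_pos_of_pos (by linarith))

lemma heatKernel_eq_integral_exp (hlam : 0 ≤ lam) {t x y : ℝ} (ht : 0 < t) (hx : 0 < x)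
    (hy : 0 < y) :
    heatKernel lam t x y = heatConst lam * t ^ (-(lam + 1 / 2)) *
      (exp (-(x ^ 2 + y ^ 2) / (4 * t)) *
        ∫ s, exp (x * y / (2 * t) * s) ∂angularMeasure lam) := by
  have hpow : (x * y) ^ (-lam + 1 / 2) / (2 * t) * (x * y / (2 * t) / 2) ^ (lam - 1 / 2) =
      2 ^ (-(2 * lam)) * t ^ (-(lam + 1 / 2)) := by
    refine log_injOn_pos (mem_Ioi.2 (by positivity)) (mem_Ioi.2 (by positivity)) ?_
    simp (disch := positivity) only [log_mul, log_div, log_rpow]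
    ring
  rw [heatKernel, besselI_eq_integral_exp hlam (by positivity), heatConst]
  linear_combination exp (-(x ^ 2 + y ^ 2) / (4 * t)) / Gamma (lam + 1 / 2) *
    (∫ s, exp (x * y / (2 * t) * s) ∂angularMeasure lam) * hpow

lemma heatKernel_eq_integral_gaussian (hlam : 0 ≤ lam) {t x y : ℝ} (ht : 0 < t) (hx : 0 < x)
    (hy : 0 < y) :
    heatKernel lam t x y = heatConst lam * t ^ (-(lam + 1 / 2)) *
      ∫ s, exp (-(x ^ 2 + y ^ 2 - 2 * x * y * s) / (4 * t)) ∂angularMeasure lam := by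
  rw [heatKernel_eq_integral_exp hlam ht hx hy, ← integral_const_mul]
  congr 2; ext s
  rw [← exp_add]; congr 1; field_simp; ring

end KernelFormula

section Laplace

universe u v

variable {Ω : Type v} [MeasurableSpace Ω] {m : Measure Ω}
  {E F : Type u} [NormedAddCommGroup E] [NormedSpace ℝ E]
  [NormedAddCommGroup F] [NormedSpace ℝ F]

/-- The Laplace transform `p ↦ ∫ exp (L w p) g(w) dm(w)` of the `F`-valued density `g`, for a
random linear functional `L` on the parameter space `E`. -/
def laplace (m : Measure Ω) (L : Ω → E →L[ℝ] ℝ) (g : Ω → F) (p : E) : F :=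
  ∫ w, exp (L w p) • g w ∂m

/-- The functional `ℓ` is at most `log (∑ i, exp (ℓ (v i)))` on the convex hull, hence also at the
points `q + ε x` with `‖x‖ < 1`, which leaves room for `ε ‖ℓ‖`. -/
lemma norm_mul_exp_le_sum {ι : Type*} [Fintype ι] (ℓ : E →L[ℝ] ℝ) {v : ι → E} {q : E} {ε : ℝ}
    (hε : 0 < ε) (hball : Metric.ball q ε ⊆ convexHull ℝ (range v)) :
    ‖ℓ‖ * exp (ℓ q) ≤ ε⁻¹ * ∑ i, exp (ℓ (v i)) := by
  set S := ∑ i, exp (ℓ (v i))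
  have : Nonempty ι := range_nonempty_iff_nonempty.1
    (convexHull_nonempty_iff.1 ⟨q, hball (Metric.mem_ball_self hε)⟩)
  have hS : 0 < S := Finset.sum_pos (fun i _ => exp_pos _) Finset.univ_nonempty
  have hhull : convexHull ℝ (range v) ⊆ {z | ℓ z ≤ log S} := by
    refine convexHull_min ?_ (convex_halfSpace_le ℓ.isLinear _)
    rintro - ⟨i, rfl⟩
    exact (le_log_iff_exp_le hS).2
      (Finset.single_le_sum (f := fun i => exp (ℓ (v i))) (fun i _ => exp_nonneg _)
        (Finset.mem_univ i))
  have hroom : ∀ x ∈ Metric.ball (0 : E) 1, ℓ x ≤ ε⁻¹ * (log S - ℓ q) := fun x hx => by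
    have hmem : q + ε • x ∈ Metric.ball q ε := by
      rw [mem_ball_zero_iff] at hx
      rw [mem_ball_iff_norm, add_sub_cancel_left, norm_smul, norm_of_nonneg hε.le]
      exact mul_lt_of_lt_one_right hε hx
    have hle : ℓ (q + ε • x) ≤ log S := hhull (hball hmem)
    rw [map_add, map_smul, smul_eq_mul] at hle
    rw [inv_mul_eq_div, le_div_iff₀ hε]
    linarith
  have hnorm : ‖ℓ‖ ≤ ε⁻¹ * (log S - ℓ q) := by
    rw [← ℓ.sSup_unit_ball_eq_norm]
    refine csSup_le ((Metric.nonempty_ball.2 one_pos).image _) ?_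
    rintro - ⟨x, hx, rfl⟩
    exact abs_le'.2 ⟨hroom x hx, by simpa using hroom (-x) (by simpa using hx)⟩
  calc ‖ℓ‖ * exp (ℓ q) ≤ ε⁻¹ * (log S - ℓ q) * exp (ℓ q) := by gcongr
    _ ≤ ε⁻¹ * exp (log S - ℓ q) * exp (ℓ q) := by
        gcongr; linarith [add_one_le_exp (log S - ℓ q)]
    _ = ε⁻¹ * S := by rw [mul_assoc, ← exp_add, sub_add_cancel, exp_log hS]

variable {L : Ω → E →L[ℝ] ℝ} {g : Ω → F} {U : Set E} {p : E}

lemma exists_laplace_majorant [FiniteDimensional ℝ E] (hU : U ∈ 𝓝 p)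
    (hg : ∀ p ∈ U, Integrable (fun w => exp (L w p) • g w) m) :
    ∃ ε > 0, ∃ B : Ω → ℝ, Integrable B m ∧ ∀ w, ∀ q ∈ Metric.ball p ε,
      ‖L w‖ * ‖exp (L w q) • g w‖ ≤ B w := by
  obtain ⟨v, hpv, hvU⟩ := exists_mem_interior_convexHull_affineBasis hU
  obtain ⟨ε, hε, hball⟩ := Metric.isOpen_iff.1 isOpen_interior p hpv
  refine ⟨ε / 2, half_pos hε, fun w => (ε / 2)⁻¹ * ∑ i, ‖exp (L w (v i)) • g w‖,
    (integrable_finsetSum _ fun i _ => ?_).const_mul _, fun w q hq => ?_⟩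
  · exact (hg _ (hvU (subset_convexHull ℝ _ (mem_range_self i)))).norm
  · have hq' : Metric.ball q (ε / 2) ⊆ convexHull ℝ (range v) :=
      (Metric.ball_subset_ball' (by linarith [Metric.mem_ball.1 hq])).trans
        (hball.trans interior_subset)
    simp only [norm_smul, norm_of_nonneg (exp_nonneg _)]
    rw [← mul_assoc, ← Finset.sum_mul, ← mul_assoc]
    exact mul_le_mul_of_nonneg_right (norm_mul_exp_le_sum (L w) (half_pos hε) hq') (norm_nonneg _)

lemma integrable_exp_smul_of_norm_le [FiniteDimensional ℝ E] {G : Type*} [NormedAddCommGroup G]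
    [NormedSpace ℝ G] {h : Ω → G} (hU : IsOpen U)
    (hg : ∀ p ∈ U, Integrable (fun w => exp (L w p) • g w) m)
    (hL : AEStronglyMeasurable L m) (hh : AEStronglyMeasurable h m)
    (hle : ∀ w, ‖h w‖ ≤ ‖L w‖ * ‖g w‖) :
    ∀ p ∈ U, Integrable (fun w => exp (L w p) • h w) m := by
  intro p hp
  obtain ⟨ε, hε, B, hB, hBle⟩ := exists_laplace_majorant (hU.mem_nhds hp) hg
  refine hB.mono' ?_ (ae_of_all _ fun w => ?_)
  · exact (continuous_exp.comp_aestronglyMeasurable (hL.apply_continuousLinearMap p)).smul hh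
  · refine le_trans ?_ (hBle w p (Metric.mem_ball_self hε))
    rw [norm_smul, norm_smul, mul_left_comm]
    gcongr
    exact hle w

lemma integrable_exp_smul_smulRight [FiniteDimensional ℝ E] (hU : IsOpen U)
    (hL : AEStronglyMeasurable L m) (hgm : AEStronglyMeasurable g m)
    (hg : ∀ p ∈ U, Integrable (fun w => exp (L w p) • g w) m) :
    ∀ p ∈ U, Integrable (fun w => exp (L w p) • (L w).smulRight (g w)) m :=
  integrable_exp_smul_of_norm_le hU hg hL
    ((ContinuousLinearMap.smulRightL ℝ E F).continuous₂.comp_aestronglyMeasurable₂ hL hgm)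
    fun _ => (ContinuousLinearMap.norm_smulRight_apply _ _).le

lemma hasFDerivAt_laplace [FiniteDimensional ℝ E] (hU : IsOpen U) (hL : AEStronglyMeasurable L m)
    (hgm : AEStronglyMeasurable g m) (hg : ∀ p ∈ U, Integrable (fun w => exp (L w p) • g w) m)
    (hp : p ∈ U) :
    HasFDerivAt (laplace m L g) (laplace m L (fun w => (L w).smulRight (g w)) p) p := by
  obtain ⟨ε, hε, B, hB, hBle⟩ := exists_laplace_majorant (hU.mem_nhds hp) hg
  refine hasFDerivAt_integral_of_dominated_of_fderiv_le
    (F' := fun q w => exp (L w q) • (L w).smulRight (g w)) (Metric.ball_mem_nhds p hε) ?_ (hg p hp)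
    (integrable_exp_smul_smulRight hU hL hgm hg p hp).aestronglyMeasurable
    (ae_of_all _ fun w q hq => ?_) hB (ae_of_all _ fun w q _ => ?_)
  · filter_upwards [hU.mem_nhds hp] with q hq using (hg q hq).aestronglyMeasurable
  · refine le_of_eq_of_le ?_ (hBle w q hq)
    rw [norm_smul, norm_smul, ContinuousLinearMap.norm_smulRight_apply, mul_left_comm]
  · refine ((L w).hasFDerivAt.exp.smul_const (g w)).congr_fderiv ?_
    ext
    simp [mul_smul]

theorem contDiffOn_laplace [FiniteDimensional ℝ E] (hU : IsOpen U) (hL : AEStronglyMeasurable L m)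
    (hgm : AEStronglyMeasurable g m) (hg : ∀ p ∈ U, Integrable (fun w => exp (L w p) • g w) m) :
    ContDiffOn ℝ ∞ (laplace m L g) U := by
  rw [contDiffOn_infty]
  intro n
  induction n generalizing F with
  | zero =>
    rw [Nat.cast_zero, contDiffOn_zero]
    exact fun p hp => (hasFDerivAt_laplace hU hL hgm hg hp).continuousAt.continuousWithinAt
  | succ n ih =>
    rw [Nat.cast_succ, contDiffOn_succ_iff_fderiv_of_isOpen hU]
    exact ⟨fun p hp =>
      (hasFDerivAt_laplace hU hL hgm hg hp).differentiableAt.differentiableWithinAt, by simp,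
      (ih ((ContinuousLinearMap.smulRightL ℝ E F).continuous₂.comp_aestronglyMeasurable₂ hL hgm)
        (integrable_exp_smul_smulRight hU hL hgm hg)).congr fun p hp =>
          (hasFDerivAt_laplace hU hL hgm hg hp).fderiv⟩

end Laplace

section LaplaceMoment

variable {Ω : Type*} [MeasurableSpace Ω] {m : Measure Ω} {a b g : Ω → ℝ} {U : Set (ℝ × ℝ)}

/-- The functional `p ↦ a p₁ + b p₂` on the plane. -/
def planeForm (a b : ℝ) : ℝ × ℝ →L[ℝ] ℝ :=
  a • ContinuousLinearMap.fst ℝ ℝ ℝ + b • ContinuousLinearMap.snd ℝ ℝ ℝ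

lemma planeForm_apply (a b : ℝ) (p : ℝ × ℝ) : planeForm a b p = a * p.1 + b * p.2 := rfl

lemma continuous_planeForm : Continuous (Function.uncurry planeForm) := by
  unfold Function.uncurry planeForm
  fun_prop

lemma abs_le_norm_planeForm_left (a b : ℝ) : |a| ≤ ‖planeForm a b‖ := by
  simpa [planeForm_apply, Prod.norm_def] using (planeForm a b).le_opNorm (1, 0)

lemma abs_le_norm_planeForm_right (a b : ℝ) : |b| ≤ ‖planeForm a b‖ := by
  simpa [planeForm_apply, Prod.norm_def] using (planeForm a b).le_opNorm (0, 1)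

/-- The mixed derivative `∂₁ⁱ ∂₂ʲ` of the Laplace transform
`p ↦ ∫ exp (a(w) p₁ + b(w) p₂) g(w) dm(w)` on the plane. -/
def laplaceMoment (m : Measure Ω) (a b g : Ω → ℝ) (i j : ℕ) : ℝ × ℝ → ℝ :=
  laplace m (fun w => planeForm (a w) (b w)) fun w => a w ^ i * b w ^ j * g w

lemma laplaceMoment_eq_integral (a b g : Ω → ℝ) (i j : ℕ) (p : ℝ × ℝ) :
    laplaceMoment m a b g i j p =
      ∫ w, exp (a w * p.1 + b w * p.2) * (a w ^ i * b w ^ j * g w) ∂m :=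
  rfl

lemma integrable_laplaceMoment (ha : AEStronglyMeasurable a m) (hb : AEStronglyMeasurable b m)
    (hgm : AEStronglyMeasurable g m) (hU : IsOpen U)
    (hg : ∀ p ∈ U, Integrable (fun w => exp (a w * p.1 + b w * p.2) * g w) m) (i j : ℕ) :
    ∀ p ∈ U, Integrable
      (fun w => exp (a w * p.1 + b w * p.2) * (a w ^ i * b w ^ j * g w)) m := by
  have hL := continuous_planeForm.comp_aestronglyMeasurable₂ ha hb
  induction i with
  | zero =>
    induction j with
    | zero => simpa only [pow_zero, one_mul] using hg
    | succ j ih =>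
      refine integrable_exp_smul_of_norm_le hU ih hL (((ha.pow 0).mul (hb.pow _)).mul hgm)
        fun w => ?_
      rw [show a w ^ 0 * b w ^ (j + 1) * g w = b w * (a w ^ 0 * b w ^ j * g w) by ring, norm_mul]
      gcongr
      exact abs_le_norm_planeForm_right _ _
  | succ i ih =>
    refine integrable_exp_smul_of_norm_le hU ih hL (((ha.pow _).mul (hb.pow _)).mul hgm)
      fun w => ?_
    rw [pow_succ', mul_assoc, mul_assoc, norm_mul, ← mul_assoc (a w ^ i)]
    gcongr
    exact abs_le_norm_planeForm_left _ _

lemma contDiffOn_laplaceMoment_zero_zero (ha : AEStronglyMeasurable a m)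
    (hb : AEStronglyMeasurable b m) (hgm : AEStronglyMeasurable g m) (hU : IsOpen U)
    (hg : ∀ p ∈ U, Integrable (fun w => exp (a w * p.1 + b w * p.2) * g w) m) :
    ContDiffOn ℝ ∞ (laplaceMoment m a b g 0 0) U := by
  simpa only [laplaceMoment, pow_zero, one_mul] using
    contDiffOn_laplace hU (continuous_planeForm.comp_aestronglyMeasurable₂ ha hb) hgm hg

lemma hasDerivAt_laplaceMoment_comp (ha : AEStronglyMeasurable a m)
    (hb : AEStronglyMeasurable b m) (hgm : AEStronglyMeasurable g m) (hU : IsOpen U)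
    (hg : ∀ p ∈ U, Integrable (fun w => exp (a w * p.1 + b w * p.2) * g w) m) (i j : ℕ)
    {α β : ℝ → ℝ} {α' β' t : ℝ} (hα : HasDerivAt α α' t) (hβ : HasDerivAt β β' t)
    (htU : (α t, β t) ∈ U) :
    HasDerivAt (fun t => laplaceMoment m a b g i j (α t, β t))
      (laplaceMoment m a b g (i + 1) j (α t, β t) * α' +
        laplaceMoment m a b g i (j + 1) (α t, β t) * β') t := by
  have hI := integrable_laplaceMoment ha hb hgm hU hg
  have hL := continuous_planeForm.comp_aestronglyMeasurable₂ ha hb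
  have hgij := ((ha.pow i).mul (hb.pow j)).mul hgm
  refine ((hasFDerivAt_laplace hU hL hgij (hI i j) htU).comp_hasDerivAt t
    (hα.prodMk hβ)).congr_deriv ?_
  rw [laplace, ContinuousLinearMap.integral_apply
    (integrable_exp_smul_smulRight hU hL hgij (hI i j) _ htU), laplaceMoment_eq_integral,
    laplaceMoment_eq_integral, ← integral_mul_const, ← integral_mul_const,
    ← integral_add ((hI (i + 1) j _ htU).mul_const α') ((hI i (j + 1) _ htU).mul_const β')]
  congr with w
  simp only [smul_apply, ContinuousLinearMap.smulRight_apply, planeForm_apply,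
    smul_eq_mul, Pi.mul_apply, Pi.pow_apply]
  ring

end LaplaceMoment

lemma iteratedDeriv_two_of_hasDerivAt {x c : ℝ} {u u' : ℝ → ℝ}
    (hu : ∀ᶠ z in 𝓝 x, HasDerivAt u (u' z) z) (hu' : HasDerivAt u' c x) :
    iteratedDeriv 2 u x = c := by
  have hderiv : deriv u =ᶠ[𝓝 x] u' := hu.mono fun z hz => hz.deriv
  rw [iteratedDeriv_succ, iteratedDeriv_one, hderiv.deriv_eq, hu'.deriv]

lemma besselOp_of_hasDerivAt {lam x c : ℝ} {u u' : ℝ → ℝ}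
    (hu : ∀ᶠ z in 𝓝 x, HasDerivAt u (u' z) z) (hu' : HasDerivAt u' c x) :
    besselOp lam u x = -c - 2 * lam / x * u' x := by
  rw [besselOp, iteratedDeriv_two_of_hasDerivAt hu hu', hu.self_of_nhds.deriv]

lemma FiniteAgainst.integrableOn {φ f : ℝ → ℝ} (h : FiniteAgainst φ f) (hφ : Measurable φ)
    (hφ0 : ∀ y, 0 < y → 0 ≤ φ y) (hf : AEMeasurable f (volume.restrict (Ioi (0 : ℝ)))) :
    IntegrableOn (fun y => φ y * |f y|) (Ioi 0) := by
  refine ⟨(hφ.aemeasurable.mul hf.norm).aestronglyMeasurable, ?_⟩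
  rw [hasFiniteIntegral_iff_ofReal]
  · exact h
  · filter_upwards [ae_restrict_mem measurableSet_Ioi] with y hy
    exact mul_nonneg (hφ0 y hy) (abs_nonneg _)

/-- The law of a pair of a radius, distributed by Lebesgue measure on `(0, ∞)`, and an independent
cosine, distributed by the angular measure. -/
def polarMeasure (lam : ℝ) : Measure (ℝ × ℝ) :=
  (volume.restrict (Ioi 0)).prod (angularMeasure lam)

instance (lam : ℝ) : SFinite (polarMeasure lam) := by
  unfold polarMeasure
  infer_instance

lemma ae_polarMeasure (lam : ℝ) : ∀ᵐ w ∂polarMeasure lam, 0 < w.1 ∧ |w.2| ≤ 1 :=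
  (Measure.quasiMeasurePreserving_fst.ae (ae_restrict_mem measurableSet_Ioi)).and
    (Measure.quasiMeasurePreserving_snd.ae ae_abs_le_one_angularMeasure)

section Heat

variable {lam t₀ t x y : ℝ} {f : ℝ → ℝ}

lemma aemeasurable_mul_rpow_polarMeasure (hf : AEMeasurable f (volume.restrict (Ioi (0 : ℝ)))) :
    AEMeasurable (fun w : ℝ × ℝ => f w.1 * w.1 ^ (2 * lam)) (polarMeasure lam) :=
  AEMeasurable.mul hf.comp_fst (measurable_fst.pow_const _).aemeasurable

lemma measurable_heatFactor (lam t : ℝ) : Measurable (heatFactor lam t) := by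
  unfold heatFactor
  fun_prop

lemma heatFactor_eq (hy : 0 < y) :
    heatFactor lam t y = y ^ (2 * lam) * (1 + y) ^ (-lam) * exp (-y ^ 2 / (4 * t)) := by
  rw [heatFactor, div_rpow hy.le (by positivity), rpow_neg (by positivity), two_mul,
    rpow_add hy, add_comm 1 y]
  ring

lemma heatFactor_pos (hy : 0 < y) : 0 < heatFactor lam t y := by
  rw [heatFactor_eq hy]
  positivity

lemma exp_neg_mul_le_one_add_rpow_neg (hlam : 0 ≤ lam) (hy : 0 ≤ y) :
    exp (-(lam * y)) ≤ (1 + y) ^ (-lam) := by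
  rw [exp_neg, rpow_neg (by positivity), mul_comm, exp_mul]
  gcongr
  linarith [add_one_le_exp y]

lemma exists_exp_mul_rpow_le_heatFactor {α : ℝ} (hlam : 0 ≤ lam) (hα : 1 / (4 * t) < α) (β : ℝ) :
    ∃ C, ∀ y, 0 < y → exp (-y ^ 2 * α + y * β) * y ^ (2 * lam) ≤ C * heatFactor lam t y := by
  have hγ : 0 < α - 1 / (4 * t) := sub_pos.2 hα
  set γ := α - 1 / (4 * t)
  refine ⟨exp ((β + lam) ^ 2 / (4 * γ)), fun y hy => ?_⟩
  have hsquare : (β + lam) * y - γ * y ^ 2 ≤ (β + lam) ^ 2 / (4 * γ) := by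
    rw [le_div_iff₀ (by positivity)]
    nlinarith [sq_nonneg (2 * γ * y - (β + lam))]
  have hexp : exp (-y ^ 2 * α + y * β) ≤
      exp ((β + lam) ^ 2 / (4 * γ)) * ((1 + y) ^ (-lam) * exp (-y ^ 2 / (4 * t))) := by
    calc exp (-y ^ 2 * α + y * β)
        ≤ exp ((β + lam) ^ 2 / (4 * γ) + (-(lam * y) + -y ^ 2 / (4 * t))) := by
          rw [exp_le_exp]
          have : y ^ 2 * α = γ * y ^ 2 - -y ^ 2 / (4 * t) := by simp only [γ]; ring
          linarith
      _ ≤ _ := by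
          rw [exp_add, exp_add]
          gcongr
          exact exp_neg_mul_le_one_add_rpow_neg hlam hy.le
  calc exp (-y ^ 2 * α + y * β) * y ^ (2 * lam)
      ≤ exp ((β + lam) ^ 2 / (4 * γ)) * ((1 + y) ^ (-lam) * exp (-y ^ 2 / (4 * t))) *
          y ^ (2 * lam) := by gcongr
    _ = _ := by rw [heatFactor_eq hy]; ring

lemma integrableOn_exp_mul_of_heatFactor {α : ℝ} (hlam : 0 ≤ lam)
    (hf : AEMeasurable f (volume.restrict (Ioi (0 : ℝ))))
    (hfin : FiniteAgainst (heatFactor lam t) f) (hα : 1 / (4 * t) < α) (β : ℝ) :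
    IntegrableOn (fun y => exp (-y ^ 2 * α + y * β) * (f y * y ^ (2 * lam))) (Ioi 0) := by
  obtain ⟨C, hC⟩ := exists_exp_mul_rpow_le_heatFactor hlam hα β
  refine Integrable.mono' ((hfin.integrableOn (measurable_heatFactor _ _)
    (fun y hy => (heatFactor_pos hy).le) hf).const_mul C) ?_ ?_
  · exact ((Measurable.aemeasurable (by fun_prop)).mul
      (hf.mul (measurable_id.pow_const _).aemeasurable)).aestronglyMeasurable
  · filter_upwards [ae_restrict_mem measurableSet_Ioi] with y (hy : 0 < y)
    rw [norm_mul, norm_mul, norm_of_nonneg (exp_nonneg _), norm_of_nonneg (rpow_nonneg hy.le _),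
      norm_eq_abs, mul_comm |f y|, ← mul_assoc, ← mul_assoc]
    exact mul_le_mul_of_nonneg_right (hC y hy) (abs_nonneg _)

lemma integrable_heatLaplace (hlam : 0 ≤ lam) (hf : AEMeasurable f (volume.restrict (Ioi (0 : ℝ))))
    (hfin : FiniteAgainst (heatFactor lam t₀) f) :
    ∀ p ∈ {p : ℝ × ℝ | 1 / (4 * t₀) < p.1}, Integrable
      (fun w : ℝ × ℝ => exp (-w.1 ^ 2 * p.1 + w.1 * w.2 * p.2) * (f w.1 * w.1 ^ (2 * lam)))
      (polarMeasure lam) := by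
  intro p hp
  refine ((integrableOn_exp_mul_of_heatFactor hlam hf hfin hp |p.2|).norm.comp_fst
    (angularMeasure lam)).mono' ((Measurable.aemeasurable (by fun_prop)).mul
      (aemeasurable_mul_rpow_polarMeasure hf)).aestronglyMeasurable ?_
  filter_upwards [ae_polarMeasure lam] with w ⟨hw1, hw2⟩
  have : w.2 * p.2 ≤ |p.2| := (le_abs_self _).trans <| by
    rw [abs_mul]
    exact mul_le_of_le_one_left (abs_nonneg _) hw2
  rw [norm_mul, norm_mul (exp _), norm_of_nonneg (exp_nonneg _), norm_of_nonneg (exp_nonneg _),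
    mul_assoc w.1]
  gcongr

/-- The moment `∂₁ⁱ ∂₂ʲ` of the Laplace transform
`(α, β) ↦ ∫ exp (-y² α + y s β) f(y) y^{2λ} dy dμ_λ(s)`, at the parameters `α = 1 / 4t` and
`β = x / 2t` that occur in the heat kernel. -/
def heatMoment (lam : ℝ) (f : ℝ → ℝ) (i j : ℕ) (t x : ℝ) : ℝ :=
  laplaceMoment (polarMeasure lam) (fun w => -w.1 ^ 2) (fun w => w.1 * w.2)
    (fun w => f w.1 * w.1 ^ (2 * lam)) i j (1 / (4 * t), x / (2 * t))

/-- The part `t^{-λ-1/2} e^{-x²/4t}` of the heat kernel that does not depend on `y`, normalised. -/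
def heatPrefactor (lam t x : ℝ) : ℝ :=
  heatConst lam * t ^ (-(lam + 1 / 2)) * exp (-x ^ 2 / (4 * t))

lemma hasDerivAt_heatPrefactor_time (lam x : ℝ) (ht : 0 < t) :
    HasDerivAt (fun s => heatPrefactor lam s x)
      (heatPrefactor lam t x * (-(lam + 1 / 2) / t + x ^ 2 / (4 * t ^ 2))) t := by
  have hpow := hasDerivAt_rpow_const (x := t) (p := -(lam + 1 / 2)) (Or.inl ht.ne')
  have harg : HasDerivAt (fun s : ℝ => -x ^ 2 / (4 * s)) (x ^ 2 / (4 * t ^ 2)) t := by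
    refine ((hasDerivAt_const t (-x ^ 2)).fun_div ((hasDerivAt_id' t).const_mul 4)
      (by positivity)).congr_deriv ?_
    field_simp
    ring
  refine ((hpow.const_mul (heatConst lam)).fun_mul harg.exp).congr_deriv ?_
  rw [heatPrefactor, rpow_sub_one ht.ne']
  field_simp

lemma hasDerivAt_heatPrefactor_space (lam t x : ℝ) :
    HasDerivAt (heatPrefactor lam t) (heatPrefactor lam t x * (-x / (2 * t))) x := by
  refine ((((hasDerivAt_pow 2 x).fun_neg.div_const (4 * t)).exp).const_mul
    (heatConst lam * t ^ (-(lam + 1 / 2)))).congr_deriv ?_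
  rw [heatPrefactor]
  push_cast
  field_simp
  ring

lemma isOpen_lt_fst (c : ℝ) : IsOpen {p : ℝ × ℝ | c < p.1} :=
  isOpen_lt continuous_const continuous_fst

lemma one_div_four_mul_lt (ht : 0 < t) (ht₀ : t < t₀) : 1 / (4 * t₀) < 1 / (4 * t) :=
  one_div_lt_one_div_of_lt (by positivity) (by linarith)

lemma heatKernel_mul_eq (hlam : 0 ≤ lam) (ht : 0 < t) (hx : 0 < x) (hy : 0 < y) (c : ℝ) :
    heatKernel lam t x y * c = heatPrefactor lam t x *
      ∫ s, exp (-y ^ 2 * (1 / (4 * t)) + y * s * (x / (2 * t))) * c ∂angularMeasure lam := by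
  have hsplit : ∀ s, exp (-(x ^ 2 + y ^ 2 - 2 * x * y * s) / (4 * t)) =
      exp (-x ^ 2 / (4 * t)) * exp (-y ^ 2 * (1 / (4 * t)) + y * s * (x / (2 * t))) := by
    intro s
    rw [← exp_add]
    congr 1
    field_simp
    ring
  rw [heatKernel_eq_integral_gaussian hlam ht hx hy, heatPrefactor, integral_mul_const]
  simp only [hsplit, integral_const_mul]
  ring

variable (hlam : 0 ≤ lam) (hf : AEMeasurable f (volume.restrict (Ioi (0 : ℝ))))
  (hfin : FiniteAgainst (heatFactor lam t₀) f)
include hlam hf hfin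

theorem integrableOn_heatKernel_mul (ht : 0 < t) (ht₀ : t < t₀) (hx : 0 < x) :
    IntegrableOn (fun y => heatKernel lam t x y * f y * y ^ (2 * lam)) (Ioi 0) := by
  refine ((integrable_heatLaplace hlam hf hfin (1 / (4 * t), x / (2 * t))
    (one_div_four_mul_lt ht ht₀)).integral_prod_left.const_mul (heatPrefactor lam t x)).congr ?_
  filter_upwards [ae_restrict_mem measurableSet_Ioi] with y hy
  rw [mul_assoc, heatKernel_mul_eq hlam ht hx hy]

lemma heatIntegral_eq (ht : 0 < t) (ht₀ : t < t₀) (hx : 0 < x) :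
    heatIntegral lam f t x = heatPrefactor lam t x * heatMoment lam f 0 0 t x := by
  simp only [heatMoment, laplaceMoment_eq_integral, pow_zero, one_mul, polarMeasure]
  rw [integral_prod _ (integrable_heatLaplace hlam hf hfin (1 / (4 * t), x / (2 * t))
    (one_div_four_mul_lt ht ht₀)), ← integral_const_mul, heatIntegral]
  exact setIntegral_congr_fun measurableSet_Ioi fun y hy =>
    (mul_assoc _ _ _).trans (heatKernel_mul_eq hlam ht hx hy _)

lemma integrable_heatMoment (i j : ℕ) : ∀ p ∈ {p : ℝ × ℝ | 1 / (4 * t₀) < p.1},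
    Integrable (fun w : ℝ × ℝ => exp (-w.1 ^ 2 * p.1 + w.1 * w.2 * p.2) *
      ((-w.1 ^ 2) ^ i * (w.1 * w.2) ^ j * (f w.1 * w.1 ^ (2 * lam)))) (polarMeasure lam) :=
  integrable_laplaceMoment (by fun_prop) (by fun_prop)
    (aemeasurable_mul_rpow_polarMeasure hf).aestronglyMeasurable (isOpen_lt_fst _)
    (integrable_heatLaplace hlam hf hfin) i j

lemma heatMoment_relation (ht : 0 < t) (ht₀ : t < t₀) (hx : x ≠ 0) :
    heatMoment lam f 0 2 t x + 4 * lam * t / x * heatMoment lam f 0 1 t x +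
      heatMoment lam f 1 0 t x = 0 := by
  have hI := fun i j => integrable_heatMoment hlam hf hfin i j (1 / (4 * t), x / (2 * t))
    (one_div_four_mul_lt ht ht₀)
  have hI₂ := (hI 0 2).fun_add ((hI 0 1).const_mul (4 * lam * t / x))
  simp only [heatMoment, laplaceMoment_eq_integral]
  rw [← integral_const_mul, ← integral_add (hI 0 2) ((hI 0 1).const_mul _),
    ← integral_add hI₂ (hI 1 0), polarMeasure, integral_prod _ (hI₂.fun_add (hI 1 0))]
  refine integral_eq_zero_of_ae (ae_of_all _ fun y => ?_)
  set z := y * (x / (2 * t))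
  trans ∫ s, (y / (x / (2 * t)) * exp (-y ^ 2 * (1 / (4 * t))) * (f y * y ^ (2 * lam))) *
    ((s ^ 2 - 1) * (z * exp (z * s)) + 2 * lam * s * exp (z * s)) ∂angularMeasure lam
  · refine integral_congr_ae (ae_of_all _ fun s => ?_)
    simp only [z]
    rw [show -y ^ 2 * (1 / (4 * t)) + y * s * (x / (2 * t)) =
      -y ^ 2 * (1 / (4 * t)) + y * (x / (2 * t)) * s by ring, exp_add]
    field_simp
    ring
  · rw [integral_const_mul, integral_exp_angularMeasure_parts hlam, mul_zero, Pi.zero_apply]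

theorem contDiffOn_heatIntegral :
    ContDiffOn ℝ ∞ (fun p : ℝ × ℝ => heatIntegral lam f p.1 p.2)
      {p : ℝ × ℝ | 0 < p.1 ∧ p.1 < t₀ ∧ 0 < p.2} := by
  have hmoment := contDiffOn_laplaceMoment_zero_zero (by fun_prop) (by fun_prop)
    (aemeasurable_mul_rpow_polarMeasure hf).aestronglyMeasurable (isOpen_lt_fst _)
    (integrable_heatLaplace hlam hf hfin)
  have hparam : ContDiffOn ℝ ∞ (fun p : ℝ × ℝ => (1 / (4 * p.1), p.2 / (2 * p.1)))
      {p : ℝ × ℝ | 0 < p.1 ∧ p.1 < t₀ ∧ 0 < p.2} :=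
    (contDiffOn_const.div (by fun_prop) fun p hp => mul_ne_zero four_ne_zero hp.1.ne').prodMk
      (contDiffOn_snd.div (by fun_prop) fun p hp => mul_ne_zero two_ne_zero hp.1.ne')
  have hprefactor : ContDiffOn ℝ ∞ (fun p : ℝ × ℝ => heatPrefactor lam p.1 p.2)
      {p : ℝ × ℝ | 0 < p.1 ∧ p.1 < t₀ ∧ 0 < p.2} :=
    (contDiffOn_const.mul (contDiffOn_fst.rpow_const_of_ne fun p hp => hp.1.ne')).mul
      (ContDiffOn.exp (ContDiffOn.div (by fun_prop) (by fun_prop)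
        fun p hp => mul_ne_zero four_ne_zero hp.1.ne'))
  exact (hprefactor.mul (hmoment.comp hparam fun p hp => one_div_four_mul_lt hp.1 hp.2.1)).congr
    fun p hp => heatIntegral_eq hlam hf hfin hp.1 hp.2.1 hp.2.2

lemma hasDerivAt_heatMoment_time (ht : 0 < t) (ht₀ : t < t₀) :
    HasDerivAt (fun s => heatMoment lam f 0 0 s x)
      (-heatMoment lam f 1 0 t x / (4 * t ^ 2) - heatMoment lam f 0 1 t x * x / (2 * t ^ 2)) t := by
  have hα : HasDerivAt (fun s : ℝ => 1 / (4 * s)) (-1 / (4 * t ^ 2)) t := by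
    refine ((hasDerivAt_const t (1 : ℝ)).fun_div ((hasDerivAt_id' t).const_mul 4)
      (by positivity)).congr_deriv ?_
    field_simp
    ring
  have hβ : HasDerivAt (fun s : ℝ => x / (2 * s)) (-x / (2 * t ^ 2)) t := by
    refine ((hasDerivAt_const t x).fun_div ((hasDerivAt_id' t).const_mul 2)
      (by positivity)).congr_deriv ?_
    field_simp
    ring
  refine (hasDerivAt_laplaceMoment_comp (by fun_prop) (by fun_prop)
    (aemeasurable_mul_rpow_polarMeasure hf).aestronglyMeasurable (isOpen_lt_fst _)
    (integrable_heatLaplace hlam hf hfin) 0 0 hα hβ (one_div_four_mul_lt ht ht₀)).congr_deriv ?_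
  simp only [heatMoment, zero_add]
  ring

lemma hasDerivAt_heatMoment_space (i j : ℕ) (ht : 0 < t) (ht₀ : t < t₀) :
    HasDerivAt (heatMoment lam f i j t) (heatMoment lam f i (j + 1) t x / (2 * t)) x := by
  refine (hasDerivAt_laplaceMoment_comp (by fun_prop) (by fun_prop)
    (aemeasurable_mul_rpow_polarMeasure hf).aestronglyMeasurable (isOpen_lt_fst _)
    (integrable_heatLaplace hlam hf hfin) i j (hasDerivAt_const x (1 / (4 * t)))
    ((hasDerivAt_id' x).div_const (2 * t)) (one_div_four_mul_lt ht ht₀)).congr_deriv ?_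
  rw [mul_zero, zero_add, mul_one_div, heatMoment]

lemma hasDerivAt_heatIntegral_time (ht : 0 < t) (ht₀ : t < t₀) (hx : 0 < x) :
    HasDerivAt (fun s => heatIntegral lam f s x)
      (heatPrefactor lam t x *
        ((-(lam + 1 / 2) / t + x ^ 2 / (4 * t ^ 2)) * heatMoment lam f 0 0 t x -
          heatMoment lam f 1 0 t x / (4 * t ^ 2) - heatMoment lam f 0 1 t x * x / (2 * t ^ 2)))
      t := by
  refine (((hasDerivAt_heatPrefactor_time lam x ht).fun_mul
    (hasDerivAt_heatMoment_time (x := x) hlam hf hfin ht ht₀)).congr_of_eventuallyEq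
      ?_).congr_deriv (by ring)
  filter_upwards [lt_mem_nhds ht, gt_mem_nhds ht₀] with s hs hs₀
  exact heatIntegral_eq hlam hf hfin hs hs₀ hx

lemma hasDerivAt_heatIntegral_space (ht : 0 < t) (ht₀ : t < t₀) (hx : 0 < x) :
    HasDerivAt (heatIntegral lam f t)
      (heatPrefactor lam t x *
        (-x / (2 * t) * heatMoment lam f 0 0 t x + heatMoment lam f 0 1 t x / (2 * t))) x := by
  refine (((hasDerivAt_heatPrefactor_space lam t x).fun_mul
    (hasDerivAt_heatMoment_space hlam hf hfin 0 0 ht ht₀)).congr_of_eventuallyEq ?_).congr_deriv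
      (by ring)
  filter_upwards [lt_mem_nhds hx] with z hz
  exact heatIntegral_eq hlam hf hfin ht ht₀ hz

lemma hasDerivAt_heatIntegral_space_space (ht : 0 < t) (ht₀ : t < t₀) :
    HasDerivAt (fun z => heatPrefactor lam t z *
        (-z / (2 * t) * heatMoment lam f 0 0 t z + heatMoment lam f 0 1 t z / (2 * t)))
      (heatPrefactor lam t x *
        ((x ^ 2 / (4 * t ^ 2) - 1 / (2 * t)) * heatMoment lam f 0 0 t x -
          heatMoment lam f 0 1 t x * x / (2 * t ^ 2) + heatMoment lam f 0 2 t x / (4 * t ^ 2)))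
      x := by
  have hM := fun j => hasDerivAt_heatMoment_space (x := x) hlam hf hfin 0 j ht ht₀
  refine ((hasDerivAt_heatPrefactor_space lam t x).fun_mul
    ((((hasDerivAt_id' x).fun_neg.div_const (2 * t)).fun_mul (hM 0)).fun_add
      ((hM 1).div_const (2 * t)))).congr_deriv ?_
  simp only [zero_add, one_add_one_eq_two]
  field_simp
  ring

theorem deriv_heatIntegral (ht : 0 < t) (ht₀ : t < t₀) (hx : 0 < x) :
    deriv (fun s => heatIntegral lam f s x) t = -besselOp lam (heatIntegral lam f t) x := by
  have hspace := (lt_mem_nhds hx).mono fun z hz =>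
    hasDerivAt_heatIntegral_space hlam hf hfin ht ht₀ hz
  rw [(hasDerivAt_heatIntegral_time hlam hf hfin ht ht₀ hx).deriv,
    besselOp_of_hasDerivAt hspace (hasDerivAt_heatIntegral_space_space hlam hf hfin ht ht₀),
    eq_neg_of_add_eq_zero_right (heatMoment_relation hlam hf hfin ht ht₀ hx.ne')]
  field_simp
  ring

end Heat

section GammaIntegral

lemma integral_rpow_mul_exp_neg_mul {p D : ℝ} (hp : 0 < p) (hD : 0 < D) :
    ∫ r in Ioi (0 : ℝ), r ^ (p - 1) * exp (-(D * r)) = Gamma p * D ^ (-p) := by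
  rw [integral_rpow_mul_exp_neg_mul_Ioi hp hD, one_div, inv_rpow hD.le, ← rpow_neg hD.le, mul_comm]

lemma integral_rpow_mul_exp_neg_div {p D : ℝ} (hp : 0 < p) (hD : 0 < D) :
    ∫ u in Ioi (0 : ℝ), u ^ (-(p + 1)) * exp (-D / (4 * u)) = Gamma p * 4 ^ p * D ^ (-p) := by
  have hsubst := integral_comp_rpow_Ioi (fun r : ℝ => r ^ (p - 1) * exp (-(D / 4 * r)))
    (show (-1 : ℝ) ≠ 0 by norm_num)
  rw [integral_rpow_mul_exp_neg_mul hp (by positivity), div_rpow hD.le (by norm_num),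
    rpow_neg (by norm_num : (0 : ℝ) ≤ 4), div_inv_eq_mul, mul_comm (D ^ _), ← mul_assoc] at hsubst
  rw [← hsubst]
  refine setIntegral_congr_fun measurableSet_Ioi fun u (hu : 0 < u) => ?_
  simp only [smul_eq_mul]
  rw [← rpow_mul hu.le, abs_neg, abs_one, one_mul, ← mul_assoc, ← rpow_add hu, rpow_neg_one]
  congr 2
  · ring
  · field_simp

lemma integrableOn_rpow_mul_exp_neg_div {p D : ℝ} (hp : 0 < p) (hD : 0 < D) :
    IntegrableOn (fun u : ℝ => u ^ (-(p + 1)) * exp (-D / (4 * u))) (Ioi 0) := by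
  refine not_imp_comm.1 integral_undef ?_
  rw [integral_rpow_mul_exp_neg_div hp hD]
  have := Gamma_pos_of_pos hp
  positivity

variable {W : Type*} [MeasurableSpace W] {ν : Measure W} {D g : W → ℝ} {p : ℝ}

lemma integrable_rpow_mul_exp_neg_mul_prod (hp : 0 < p) (hD : AEMeasurable D ν)
    (hg : AEMeasurable g ν) (hD0 : ∀ᵐ w ∂ν, 0 < D w)
    (hDg : Integrable (fun w => D w ^ (-p) * g w) ν) :
    Integrable (fun w : W × ℝ => w.2 ^ (p - 1) * exp (-(D w.1 * w.2)) * g w.1)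
      (ν.prod (volume.restrict (Ioi 0))) := by
  rw [integrable_prod_iff]
  · constructor
    · filter_upwards [hD0] with w hw
      exact (integrableOn_rpow_mul_exp_neg_mul hp hw).mul_const _
    · refine (hDg.norm.const_mul (Gamma p)).congr ?_
      filter_upwards [hD0] with w hw
      rw [setIntegral_congr_fun (g := fun r => r ^ (p - 1) * exp (-(D w * r)) * ‖g w‖)
        measurableSet_Ioi, integral_mul_const, integral_rpow_mul_exp_neg_mul hp hw, norm_mul,
        norm_of_nonneg (by positivity), mul_assoc]
      intro r (hr : 0 < r)
      simp only [norm_mul, norm_of_nonneg (rpow_nonneg hr.le _), norm_of_nonneg (exp_nonneg _)]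
  · exact (((measurable_snd.pow_const _).aemeasurable.mul
      (hD.comp_fst.mul measurable_snd.aemeasurable).neg.exp).mul hg.comp_fst).aestronglyMeasurable

variable [SFinite ν]

lemma integral_rpow_mul_exp_neg_mul_prod (hp : 0 < p) (hD : AEMeasurable D ν)
    (hg : AEMeasurable g ν) (hD0 : ∀ᵐ w ∂ν, 0 < D w)
    (hDg : Integrable (fun w => D w ^ (-p) * g w) ν) :
    ∫ w, w.2 ^ (p - 1) * exp (-(D w.1 * w.2)) * g w.1 ∂ν.prod (volume.restrict (Ioi 0)) =
      Gamma p * ∫ w, D w ^ (-p) * g w ∂ν := by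
  rw [integral_prod _ (integrable_rpow_mul_exp_neg_mul_prod hp hD hg hD0 hDg),
    ← integral_const_mul]
  refine integral_congr_ae ?_
  filter_upwards [hD0] with w hw
  rw [integral_mul_const, integral_rpow_mul_exp_neg_mul hp hw, mul_assoc]

/-- Infinitesimal invariance of the left-hand side of `integral_rpow_mul_exp_neg_mul_prod` under
dilations of `r = w.2`. -/
lemma integral_dilation_eq_zero (hp : 0 < p) (hD : AEMeasurable D ν)
    (hg : AEMeasurable g ν) (hD0 : ∀ᵐ w ∂ν, 0 < D w)
    (hDg : Integrable (fun w => D w ^ (-p) * g w) ν) :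
    Integrable (fun w : W × ℝ => (D w.1 * w.2 - p) *
        (w.2 ^ (p - 1) * exp (-(D w.1 * w.2)) * g w.1)) (ν.prod (volume.restrict (Ioi 0))) ∧
      ∫ w, (D w.1 * w.2 - p) * (w.2 ^ (p - 1) * exp (-(D w.1 * w.2)) * g w.1)
        ∂ν.prod (volume.restrict (Ioi 0)) = 0 := by
  have hlower : (fun w => D w ^ (-(p + 1)) * (D w * g w)) =ᵐ[ν] fun w => D w ^ (-p) * g w := by
    filter_upwards [hD0] with w hw
    rw [← mul_assoc, ← rpow_add_one hw.ne', neg_add, neg_add_cancel_right]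
  have hp' : 0 < p + 1 := by linarith
  have hI := integrable_rpow_mul_exp_neg_mul_prod hp hD hg hD0 hDg
  have hI' := integrable_rpow_mul_exp_neg_mul_prod hp' hD (hD.fun_mul hg) hD0
    (hDg.congr hlower.symm)
  have hsub : (fun w : W × ℝ => w.2 ^ (p + 1 - 1) * exp (-(D w.1 * w.2)) * (D w.1 * g w.1) -
        p * (w.2 ^ (p - 1) * exp (-(D w.1 * w.2)) * g w.1))
      =ᵐ[ν.prod (volume.restrict (Ioi 0))]
      fun w => (D w.1 * w.2 - p) * (w.2 ^ (p - 1) * exp (-(D w.1 * w.2)) * g w.1) := by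
    filter_upwards [Measure.quasiMeasurePreserving_snd.ae (ae_restrict_mem measurableSet_Ioi)]
      with w (hw : 0 < w.2)
    rw [add_sub_right_comm, rpow_add_one hw.ne']
    ring
  refine ⟨(hI'.sub (hI.const_mul p)).congr hsub, ?_⟩
  rw [← integral_congr_ae hsub, integral_sub hI' (hI.const_mul p), integral_const_mul,
    integral_rpow_mul_exp_neg_mul_prod hp hD hg hD0 hDg,
    integral_rpow_mul_exp_neg_mul_prod hp' hD (hD.fun_mul hg) hD0 (hDg.congr hlower.symm),
    integral_congr_ae hlower, Gamma_add_one hp.ne', mul_assoc, sub_self]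

end GammaIntegral

section PoissonKernel

variable {lam q t x y s : ℝ}

/-- The quantity `q + y² - 2 x y s`; its value at `q = t² + x²` is the one whose powers are averaged
in the Poisson kernel. -/
def poissonBase (q x y s : ℝ) : ℝ :=
  q + y ^ 2 - 2 * x * y * s

lemma sq_sub_add_le_poissonBase (hx : 0 < x) (hy : 0 < y) (hs : |s| ≤ 1) :
    (x - y) ^ 2 + (q - x ^ 2) ≤ poissonBase q x y s := by
  unfold poissonBase
  nlinarith [(abs_le.1 hs).2, mul_pos hx hy]

lemma exists_mul_sq_add_one_le_poissonBase (hq : x ^ 2 < q) :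
    ∃ κ > 0, ∀ y s, |s| ≤ 1 → κ * (y ^ 2 + 1) ≤ poissonBase q x y s := by
  have hq0 : 0 < q := (sq_nonneg x).trans_lt hq
  set κ := (q - x ^ 2) / (1 + q)
  have hκ : κ * (1 + q) = q - x ^ 2 := div_mul_cancel₀ _ (by positivity)
  have hκ1 : κ < 1 := (div_lt_one (by positivity)).2 (by nlinarith [sq_nonneg x])
  refine ⟨κ, div_pos (sub_pos.2 hq) (by positivity), fun y s hs => ?_⟩
  have hxys : x * y * s ≤ |x| * |y| := by
    refine (le_abs_self _).trans ?_
    rw [abs_mul, abs_mul]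
    exact mul_le_of_le_one_right (by positivity) hs
  have hsquare : 0 ≤ (1 - κ) * ((1 - κ) * |y| ^ 2 - 2 * (|x| * |y|) + (q - κ)) := by
    have : (1 - κ) * ((1 - κ) * |y| ^ 2 - 2 * (|x| * |y|) + (q - κ)) =
        ((1 - κ) * |y| - |x|) ^ 2 + κ ^ 2 + (q - |x| ^ 2 - κ * (1 + q)) := by ring
    rw [this, sq_abs x, hκ, sub_self, add_zero]
    positivity
  have := nonneg_of_mul_nonneg_right hsquare (sub_pos.2 hκ1)
  rw [sq_abs] at this
  unfold poissonBase
  linarith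

lemma poissonBase_pos (hq : x ^ 2 < q) (hs : |s| ≤ 1) : 0 < poissonBase q x y s := by
  obtain ⟨κ, hκ, hle⟩ := exists_mul_sq_add_one_le_poissonBase hq
  exact lt_of_lt_of_le (by positivity) (hle y s hs)

/-- The normalising constant of the Poisson kernel. -/
def poissonConst (lam : ℝ) : ℝ :=
  heatConst lam * Gamma (lam + 1) * 4 ^ (lam + 1) / √(4 * π)

lemma poissonConst_pos (hlam : 0 ≤ lam) : 0 < poissonConst lam := by
  have := heatConst_pos hlam
  have := Gamma_pos_of_pos (by linarith : 0 < lam + 1)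
  unfold poissonConst
  positivity

lemma exp_mul_heatKernel_div (hlam : 0 ≤ lam) {u : ℝ} (hu : 0 < u) (hx : 0 < x) (hy : 0 < y) :
    exp (-t ^ 2 / (4 * u)) * heatKernel lam u x y / u ^ (3 / 2 : ℝ) =
      heatConst lam * ∫ s, u ^ (-(lam + 1 + 1)) *
        exp (-poissonBase (t ^ 2 + x ^ 2) x y s / (4 * u)) ∂angularMeasure lam := by
  have hexp : ∀ s, exp (-poissonBase (t ^ 2 + x ^ 2) x y s / (4 * u)) =
      exp (-t ^ 2 / (4 * u)) * exp (-(x ^ 2 + y ^ 2 - 2 * x * y * s) / (4 * u)) := by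
    intro s
    rw [← exp_add, poissonBase]
    ring_nf
  have hpow : u ^ (-(lam + 1 + 1)) = u ^ (-(lam + 1 / 2)) / u ^ (3 / 2 : ℝ) := by
    rw [← rpow_sub hu]
    ring_nf
  simp only [hexp, integral_const_mul]
  rw [heatKernel_eq_integral_gaussian hlam hu hx hy, hpow]
  ring

lemma integrable_subordination (hlam : 0 ≤ lam) (ht : 0 < t) (hx : 0 < x) (hy : 0 < y) :
    Integrable (fun w : ℝ × ℝ => w.1 ^ (-(lam + 1 + 1)) *
      exp (-poissonBase (t ^ 2 + x ^ 2) x y w.2 / (4 * w.1))) (polarMeasure lam) := by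
  refine ((integrableOn_rpow_mul_exp_neg_div (by linarith : 0 < lam + 1)
    (by positivity : 0 < t ^ 2)).comp_fst (angularMeasure lam)).mono' ?_ ?_
  · unfold poissonBase
    exact Measurable.aestronglyMeasurable (by fun_prop)
  · filter_upwards [ae_polarMeasure lam] with w ⟨hw, hs⟩
    have hle : t ^ 2 ≤ poissonBase (t ^ 2 + x ^ 2) x y w.2 := by
      linarith [sq_sub_add_le_poissonBase (q := t ^ 2 + x ^ 2) hx hy hs, sq_nonneg (x - y)]
    rw [norm_of_nonneg (by positivity)]
    gcongr

lemma poissonKernel_eq_integral (hlam : 0 ≤ lam) (ht : 0 < t) (hx : 0 < x) (hy : 0 < y) :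
    poissonKernel lam t x y = poissonConst lam * t *
      ∫ s, poissonBase (t ^ 2 + x ^ 2) x y s ^ (-(lam + 1)) ∂angularMeasure lam := by
  have hinner : ∀ᵐ s ∂angularMeasure lam, ∫ u in Ioi (0 : ℝ), u ^ (-(lam + 1 + 1)) *
        exp (-poissonBase (t ^ 2 + x ^ 2) x y s / (4 * u)) =
      Gamma (lam + 1) * 4 ^ (lam + 1) * poissonBase (t ^ 2 + x ^ 2) x y s ^ (-(lam + 1)) := by
    filter_upwards [ae_abs_le_one_angularMeasure] with s hs
    exact integral_rpow_mul_exp_neg_div (by linarith)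
      (poissonBase_pos (lt_add_of_pos_left _ (by positivity)) hs)
  rw [poissonKernel, setIntegral_congr_fun measurableSet_Ioi fun u hu =>
    exp_mul_heatKernel_div hlam hu hx hy, integral_const_mul, integral_integral_swap
      (integrable_subordination hlam ht hx hy), integral_congr_ae hinner, integral_const_mul,
    poissonConst]
  ring

end PoissonKernel

section Poisson

variable {lam q t x y : ℝ} {f : ℝ → ℝ}

lemma measurable_poissonFactor (lam : ℝ) : Measurable (poissonFactor lam) := by
  unfold poissonFactor
  fun_prop

lemma poissonFactor_pos (hy : 0 < y) : 0 < poissonFactor lam y := by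
  unfold poissonFactor
  positivity

lemma measurable_poissonBase (q x : ℝ) :
    Measurable fun w : ℝ × ℝ => poissonBase q x w.1 w.2 := by
  unfold poissonBase
  fun_prop

lemma ae_poissonBase_pos (lam : ℝ) (hq : x ^ 2 < q) :
    ∀ᵐ w ∂polarMeasure lam, 0 < poissonBase q x w.1 w.2 :=
  (ae_polarMeasure lam).mono fun _ hw => poissonBase_pos hq hw.2

lemma integrable_poissonBase_rpow_mul {σ : ℝ}
    (hf : AEMeasurable f (volume.restrict (Ioi (0 : ℝ))))
    (hfin : FiniteAgainst (poissonFactor lam) f) (hlam : 0 ≤ lam) (hσ : lam + 1 ≤ σ)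
    (hq : x ^ 2 < q) :
    Integrable (fun w : ℝ × ℝ => poissonBase q x w.1 w.2 ^ (-σ) * (f w.1 * w.1 ^ (2 * lam)))
      (polarMeasure lam) := by
  obtain ⟨κ, hκ, hle⟩ := exists_mul_sq_add_one_le_poissonBase hq
  refine (((hfin.integrableOn (measurable_poissonFactor lam)
    (fun y hy => (poissonFactor_pos hy).le) hf).const_mul (κ ^ (-σ))).comp_fst
      (angularMeasure lam)).mono' ?_ ?_
  · exact (((measurable_poissonBase q x).pow_const _).aemeasurable.mul
      (aemeasurable_mul_rpow_polarMeasure hf)).aestronglyMeasurable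
  · filter_upwards [ae_polarMeasure lam] with w ⟨hw, hs⟩
    have := poissonBase_pos (y := w.1) hq hs
    rw [norm_mul, norm_mul, norm_of_nonneg (by positivity),
      norm_of_nonneg (rpow_nonneg hw.le _), norm_eq_abs, poissonFactor]
    calc poissonBase q x w.1 w.2 ^ (-σ) * (|f w.1| * w.1 ^ (2 * lam))
        ≤ (κ * (w.1 ^ 2 + 1)) ^ (-σ) * (|f w.1| * w.1 ^ (2 * lam)) := by
          gcongr ?_ * _
          exact rpow_le_rpow_of_nonpos (by positivity) (hle _ _ hs) (by linarith)
      _ ≤ κ ^ (-σ) * (w.1 ^ 2 + 1) ^ (-(lam + 1)) * (|f w.1| * w.1 ^ (2 * lam)) := by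
          rw [mul_rpow hκ.le (by positivity)]
          gcongr
          exact le_add_of_nonneg_left (sq_nonneg _)
      _ = _ := by
          rw [rpow_neg (by positivity : 0 ≤ w.1 ^ 2 + 1)]
          ring

/-- The polar measure together with the Lebesgue measure of the variable `r > 0` in
`Γ(λ+1) D^{-λ-1} = ∫ r^λ e^{-Dr} dr`. -/
def poissonMeasure (lam : ℝ) : Measure ((ℝ × ℝ) × ℝ) :=
  (polarMeasure lam).prod (volume.restrict (Ioi 0))

/-- The factor of `r^λ e^{-Dr} f(y) y^{2λ}`, with `D = poissonBase q x y s`, that does not depend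
on the parameters `q` and `x`, as a function of `w = ((y, s), r)`. -/
def poissonDensity (lam : ℝ) (f : ℝ → ℝ) (w : (ℝ × ℝ) × ℝ) : ℝ :=
  w.2 ^ lam * exp (-(w.2 * w.1.1 ^ 2)) * (f w.1.1 * w.1.1 ^ (2 * lam))

lemma exp_mul_poissonDensity (lam q x : ℝ) (f : ℝ → ℝ) (w : (ℝ × ℝ) × ℝ) :
    exp (-w.2 * q + 2 * w.2 * w.1.1 * w.1.2 * x) * poissonDensity lam f w =
      w.2 ^ lam * exp (-(poissonBase q x w.1.1 w.1.2 * w.2)) * (f w.1.1 * w.1.1 ^ (2 * lam)) := by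
  rw [poissonDensity, poissonBase, show -((q + w.1.1 ^ 2 - 2 * x * w.1.1 * w.1.2) * w.2) =
    -w.2 * q + 2 * w.2 * w.1.1 * w.1.2 * x + -(w.2 * w.1.1 ^ 2) by ring, exp_add _ (-(_ * _))]
  ring

/-- The moment `∂₁ⁱ ∂₂ʲ` of the Laplace transform
`(q, x) ↦ ∫ exp (-r q + 2 r y s x) r^λ exp (-r y²) f(y) y^{2λ} dr dy dμ_λ(s)`, at the parameters
`q = t² + x²` and `x` that occur in the Poisson kernel. -/
def poissonMoment (lam : ℝ) (f : ℝ → ℝ) (i j : ℕ) (t x : ℝ) : ℝ :=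
  laplaceMoment (poissonMeasure lam) (fun w => -w.2) (fun w => 2 * w.2 * w.1.1 * w.1.2)
    (poissonDensity lam f) i j (t ^ 2 + x ^ 2, x)

lemma aestronglyMeasurable_poissonDensity (hf : AEMeasurable f (volume.restrict (Ioi (0 : ℝ)))) :
    AEStronglyMeasurable (poissonDensity lam f) (poissonMeasure lam) :=
  ((Measurable.aemeasurable (by fun_prop)).mul
    (aemeasurable_mul_rpow_polarMeasure hf).comp_fst).aestronglyMeasurable

lemma isOpen_sq_snd_lt_fst : IsOpen {p : ℝ × ℝ | p.2 ^ 2 < p.1} :=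
  isOpen_lt (by fun_prop) continuous_fst

lemma sq_lt_sq_add_sq (x : ℝ) (ht : 0 < t) : x ^ 2 < t ^ 2 + x ^ 2 :=
  lt_add_of_pos_left _ (by positivity)

lemma integral_poissonMeasure_parts (hlam : 0 ≤ lam) {c z : ℝ → ℝ → ℝ}
    (hI : Integrable (fun w : (ℝ × ℝ) × ℝ => c w.1.1 w.2 *
      ((w.1.2 ^ 2 - 1) * (z w.1.1 w.2 * exp (z w.1.1 w.2 * w.1.2)) +
        2 * lam * w.1.2 * exp (z w.1.1 w.2 * w.1.2))) (poissonMeasure lam)) :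
    ∫ w, c w.1.1 w.2 * ((w.1.2 ^ 2 - 1) * (z w.1.1 w.2 * exp (z w.1.1 w.2 * w.1.2)) +
      2 * lam * w.1.2 * exp (z w.1.1 w.2 * w.1.2)) ∂poissonMeasure lam = 0 := by
  rw [poissonMeasure, polarMeasure] at hI ⊢
  rw [integral_prod_symm _ hI]
  refine integral_eq_zero_of_ae ?_
  filter_upwards [hI.prod_left_ae] with r hr
  rw [integral_prod _ hr]
  refine integral_eq_zero_of_ae (ae_of_all _ fun y => ?_)
  simp only [integral_const_mul, integral_exp_angularMeasure_parts hlam, mul_zero, Pi.zero_apply]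

variable (hlam : 0 ≤ lam) (hf : AEMeasurable f (volume.restrict (Ioi (0 : ℝ))))
  (hfin : FiniteAgainst (poissonFactor lam) f)
include hlam hf hfin

lemma integrable_poissonLaplace :
    ∀ p ∈ {p : ℝ × ℝ | p.2 ^ 2 < p.1}, Integrable (fun w : (ℝ × ℝ) × ℝ =>
      exp (-w.2 * p.1 + 2 * w.2 * w.1.1 * w.1.2 * p.2) * poissonDensity lam f w)
      (poissonMeasure lam) := by
  intro p hp
  simp only [exp_mul_poissonDensity]
  simpa only [add_sub_cancel_right, poissonMeasure] using integrable_rpow_mul_exp_neg_mul_prod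
    (by linarith : 0 < lam + 1) (measurable_poissonBase p.1 p.2).aemeasurable
    (aemeasurable_mul_rpow_polarMeasure hf) (ae_poissonBase_pos lam hp)
    (integrable_poissonBase_rpow_mul hf hfin hlam le_rfl hp)

theorem integrableOn_poissonKernel_mul (ht : 0 < t) (hx : 0 < x) :
    IntegrableOn (fun y => poissonKernel lam t x y * f y * y ^ (2 * lam)) (Ioi 0) := by
  refine ((integrable_poissonBase_rpow_mul hf hfin hlam le_rfl
    (sq_lt_sq_add_sq x ht)).integral_prod_left.const_mul (poissonConst lam * t)).congr ?_
  filter_upwards [ae_restrict_mem measurableSet_Ioi] with y hy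
  rw [mul_assoc (poissonKernel _ _ _ _), poissonKernel_eq_integral hlam ht hx hy,
    integral_mul_const]
  ring

lemma poissonIntegral_eq (ht : 0 < t) (hx : 0 < x) :
    poissonIntegral lam f t x =
      poissonConst lam / Gamma (lam + 1) * (t * poissonMoment lam f 0 0 t x) := by
  have hlam1 : 0 < lam + 1 := by linarith
  have hq := sq_lt_sq_add_sq x ht
  have hI := integrable_poissonBase_rpow_mul hf hfin hlam le_rfl hq
  have hmoment : poissonMoment lam f 0 0 t x = Gamma (lam + 1) *
      ∫ w, poissonBase (t ^ 2 + x ^ 2) x w.1 w.2 ^ (-(lam + 1)) * (f w.1 * w.1 ^ (2 * lam))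
        ∂polarMeasure lam := by
    rw [← integral_rpow_mul_exp_neg_mul_prod hlam1 (measurable_poissonBase _ _).aemeasurable
      (aemeasurable_mul_rpow_polarMeasure hf) (ae_poissonBase_pos lam hq) hI]
    simp only [poissonMoment, laplaceMoment_eq_integral, pow_zero, one_mul,
      exp_mul_poissonDensity, add_sub_cancel_right, poissonMeasure]
  have hkernel : ∀ y ∈ Ioi (0 : ℝ), poissonKernel lam t x y * f y * y ^ (2 * lam) =
      poissonConst lam * t * ∫ s, poissonBase (t ^ 2 + x ^ 2) x y s ^ (-(lam + 1)) *
        (f y * y ^ (2 * lam)) ∂angularMeasure lam := fun y hy => by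
    rw [mul_assoc (poissonKernel _ _ _ _), poissonKernel_eq_integral hlam ht hx hy,
      integral_mul_const, mul_assoc]
  rw [poissonIntegral, setIntegral_congr_fun measurableSet_Ioi hkernel, integral_const_mul,
    hmoment, polarMeasure, integral_prod _ hI]
  have := (Gamma_pos_of_pos hlam1).ne'
  field_simp

theorem contDiffOn_poissonIntegral :
    ContDiffOn ℝ ∞ (fun p : ℝ × ℝ => poissonIntegral lam f p.1 p.2)
      {p : ℝ × ℝ | 0 < p.1 ∧ 0 < p.2} := by
  have hmoment := contDiffOn_laplaceMoment_zero_zero (by fun_prop) (by fun_prop)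
    (aestronglyMeasurable_poissonDensity hf) isOpen_sq_snd_lt_fst
    (integrable_poissonLaplace hlam hf hfin)
  have hparam : ContDiffOn ℝ ∞ (fun p : ℝ × ℝ => (p.1 ^ 2 + p.2 ^ 2, p.2))
      {p : ℝ × ℝ | 0 < p.1 ∧ 0 < p.2} := by fun_prop
  exact (contDiffOn_const.mul (contDiffOn_fst.mul
    (hmoment.comp hparam fun p hp => sq_lt_sq_add_sq p.2 hp.1))).congr
    fun p hp => poissonIntegral_eq hlam hf hfin hp.1 hp.2

lemma integrable_poissonMoment (i j : ℕ) : ∀ p ∈ {p : ℝ × ℝ | p.2 ^ 2 < p.1},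
    Integrable (fun w : (ℝ × ℝ) × ℝ => exp (-w.2 * p.1 + 2 * w.2 * w.1.1 * w.1.2 * p.2) *
      ((-w.2) ^ i * (2 * w.2 * w.1.1 * w.1.2) ^ j * poissonDensity lam f w))
      (poissonMeasure lam) :=
  integrable_laplaceMoment (by fun_prop) (by fun_prop) (aestronglyMeasurable_poissonDensity hf)
    isOpen_sq_snd_lt_fst (integrable_poissonLaplace hlam hf hfin) i j

lemma integral_poissonMeasure_dilation_eq_zero (hq : x ^ 2 < q) :
    Integrable (fun w : (ℝ × ℝ) × ℝ => (poissonBase q x w.1.1 w.1.2 * w.2 - (lam + 2)) * w.2 *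
        (exp (-w.2 * q + 2 * w.2 * w.1.1 * w.1.2 * x) * poissonDensity lam f w))
        (poissonMeasure lam) ∧
      ∫ w, (poissonBase q x w.1.1 w.1.2 * w.2 - (lam + 2)) * w.2 *
        (exp (-w.2 * q + 2 * w.2 * w.1.1 * w.1.2 * x) * poissonDensity lam f w)
        ∂poissonMeasure lam = 0 := by
  have hcongr : (fun w : (ℝ × ℝ) × ℝ => (poissonBase q x w.1.1 w.1.2 * w.2 - (lam + 2)) *
        (w.2 ^ (lam + 2 - 1) * exp (-(poissonBase q x w.1.1 w.1.2 * w.2)) *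
          (f w.1.1 * w.1.1 ^ (2 * lam)))) =ᵐ[poissonMeasure lam]
      fun w => (poissonBase q x w.1.1 w.1.2 * w.2 - (lam + 2)) * w.2 *
        (exp (-w.2 * q + 2 * w.2 * w.1.1 * w.1.2 * x) * poissonDensity lam f w) := by
    filter_upwards [Measure.quasiMeasurePreserving_snd.ae (ae_restrict_mem measurableSet_Ioi)]
      with w (hw : 0 < w.2)
    rw [exp_mul_poissonDensity, show lam + 2 - 1 = lam + 1 by ring, rpow_add_one hw.ne']
    ring
  have hdilation := integral_dilation_eq_zero (by linarith : 0 < lam + 2)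
    (measurable_poissonBase q x).aemeasurable (aemeasurable_mul_rpow_polarMeasure hf)
    (ae_poissonBase_pos lam hq)
    (integrable_poissonBase_rpow_mul hf hfin hlam (by linarith : lam + 1 ≤ lam + 2) hq)
  exact ⟨hdilation.1.congr hcongr, (integral_congr_ae hcongr).symm.trans hdilation.2⟩

lemma poissonMoment_relation (ht : 0 < t) (hx : x ≠ 0) :
    (8 + 4 * lam) * poissonMoment lam f 1 0 t x +
      4 * (t ^ 2 + x ^ 2) * poissonMoment lam f 2 0 t x +
      4 * x * poissonMoment lam f 1 1 t x + poissonMoment lam f 0 2 t x +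
      2 * lam / x * poissonMoment lam f 0 1 t x = 0 := by
  have hq := sq_lt_sq_add_sq x ht
  obtain ⟨hFI, hF⟩ := integral_poissonMeasure_dilation_eq_zero hlam hf hfin hq
  set q := t ^ 2 + x ^ 2
  set E : ℕ → ℕ → (ℝ × ℝ) × ℝ → ℝ := fun i j w => exp (-w.2 * q + 2 * w.2 * w.1.1 * w.1.2 * x) *
    ((-w.2) ^ i * (2 * w.2 * w.1.1 * w.1.2) ^ j * poissonDensity lam f w) with hE
  have hI : ∀ i j, Integrable (E i j) (poissonMeasure lam) := fun i j =>
    integrable_poissonMoment hlam hf hfin i j (q, x) hq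
  have hI₁ := ((hI 1 0).const_mul (8 + 4 * lam)).fun_add ((hI 2 0).const_mul (4 * q))
  have hI₂ := hI₁.fun_add ((hI 1 1).const_mul (4 * x))
  have hI₃ := hI₂.fun_add (hI 0 2)
  have hI₄ := hI₃.fun_add ((hI 0 1).const_mul (2 * lam / x))
  have hdecomp : ∀ w : (ℝ × ℝ) × ℝ, (8 + 4 * lam) * E 1 0 w + 4 * q * E 2 0 w + 4 * x * E 1 1 w +
      E 0 2 w + 2 * lam / x * E 0 1 w -
      4 * ((poissonBase q x w.1.1 w.1.2 * w.2 - (lam + 2)) * w.2 *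
        (exp (-w.2 * q + 2 * w.2 * w.1.1 * w.1.2 * x) * poissonDensity lam f w)) =
      2 * w.2 * w.1.1 / x * (exp (-w.2 * q) * poissonDensity lam f ((w.1.1, 0), w.2)) *
      ((w.1.2 ^ 2 - 1) * (2 * w.2 * w.1.1 * x * exp (2 * w.2 * w.1.1 * x * w.1.2)) +
        2 * lam * w.1.2 * exp (2 * w.2 * w.1.1 * x * w.1.2)) := fun w => by
    simp only [hE, exp_add, poissonDensity, poissonBase]
    rw [show 2 * w.2 * w.1.1 * w.1.2 * x = 2 * w.2 * w.1.1 * x * w.1.2 by ring]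
    field_simp
    ring
  have hparts := integral_poissonMeasure_parts hlam
    (c := fun y r => 2 * r * y / x * (exp (-r * q) * poissonDensity lam f ((y, 0), r)))
    (z := fun y r => 2 * r * y * x)
    ((hI₄.sub (hFI.const_mul 4)).congr (ae_of_all _ hdecomp))
  rw [← integral_congr_ae (ae_of_all _ hdecomp), integral_sub hI₄ (hFI.const_mul 4),
    integral_const_mul, hF, mul_zero, sub_zero, integral_add hI₃ ((hI 0 1).const_mul _),
    integral_add hI₂ (hI 0 2), integral_add hI₁ ((hI 1 1).const_mul _),
    integral_add ((hI 1 0).const_mul _) ((hI 2 0).const_mul _)] at hparts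
  simp only [integral_const_mul] at hparts
  exact hparts

lemma hasDerivAt_poissonMoment_time (i j : ℕ) (x : ℝ) (ht : 0 < t) :
    HasDerivAt (fun s => poissonMoment lam f i j s x)
      (poissonMoment lam f (i + 1) j t x * (2 * t)) t := by
  refine (hasDerivAt_laplaceMoment_comp (by fun_prop) (by fun_prop)
    (aestronglyMeasurable_poissonDensity hf) isOpen_sq_snd_lt_fst
    (integrable_poissonLaplace hlam hf hfin) i j ((hasDerivAt_pow 2 t).add_const (x ^ 2))
    (hasDerivAt_const t x) (sq_lt_sq_add_sq x ht)).congr_deriv ?_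
  rw [poissonMoment]
  push_cast
  ring

lemma hasDerivAt_poissonMoment_space (i j : ℕ) (ht : 0 < t) (x : ℝ) :
    HasDerivAt (poissonMoment lam f i j t)
      (poissonMoment lam f (i + 1) j t x * (2 * x) + poissonMoment lam f i (j + 1) t x) x := by
  refine (hasDerivAt_laplaceMoment_comp (by fun_prop) (by fun_prop)
    (aestronglyMeasurable_poissonDensity hf) isOpen_sq_snd_lt_fst
    (integrable_poissonLaplace hlam hf hfin) i j ((hasDerivAt_pow 2 x).const_add (t ^ 2))
    (hasDerivAt_id' x) (sq_lt_sq_add_sq x ht)).congr_deriv ?_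
  rw [poissonMoment, poissonMoment]
  push_cast
  ring

lemma hasDerivAt_poissonIntegral_time (ht : 0 < t) (hx : 0 < x) :
    HasDerivAt (fun s => poissonIntegral lam f s x)
      (poissonConst lam / Gamma (lam + 1) *
        (poissonMoment lam f 0 0 t x + 2 * t ^ 2 * poissonMoment lam f 1 0 t x)) t := by
  refine ((((hasDerivAt_id' t).fun_mul (hasDerivAt_poissonMoment_time hlam hf hfin 0 0 x
    ht)).const_mul (poissonConst lam / Gamma (lam + 1))).congr_of_eventuallyEq ?_).congr_deriv
      (by ring)
  filter_upwards [lt_mem_nhds ht] with s hs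
  exact poissonIntegral_eq hlam hf hfin hs hx

lemma hasDerivAt_poissonIntegral_space (ht : 0 < t) (hx : 0 < x) :
    HasDerivAt (poissonIntegral lam f t)
      (poissonConst lam / Gamma (lam + 1) *
        (t * (poissonMoment lam f 1 0 t x * (2 * x) + poissonMoment lam f 0 1 t x))) x := by
  refine (((hasDerivAt_poissonMoment_space hlam hf hfin 0 0 ht x).const_mul t).const_mul
    (poissonConst lam / Gamma (lam + 1))).congr_of_eventuallyEq ?_
  filter_upwards [lt_mem_nhds hx] with z hz
  exact poissonIntegral_eq hlam hf hfin ht hz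

theorem iteratedDeriv_two_poissonIntegral (ht : 0 < t) (hx : 0 < x) :
    iteratedDeriv 2 (fun s => poissonIntegral lam f s x) t =
      besselOp lam (poissonIntegral lam f t) x := by
  have htime := (lt_mem_nhds ht).mono fun s hs =>
    hasDerivAt_poissonIntegral_time hlam hf hfin hs hx
  have hspace := (lt_mem_nhds hx).mono fun z hz =>
    hasDerivAt_poissonIntegral_space hlam hf hfin ht hz
  have hMt := fun i => hasDerivAt_poissonMoment_time hlam hf hfin i 0 x ht
  have hMx := fun i j => hasDerivAt_poissonMoment_space hlam hf hfin i j ht x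
  rw [iteratedDeriv_two_of_hasDerivAt htime (((hMt 0).fun_add
      (((hasDerivAt_pow 2 t).const_mul 2).fun_mul (hMt 1))).const_mul _),
    besselOp_of_hasDerivAt hspace (((((hMx 1 0).fun_mul ((hasDerivAt_id' x).const_mul 2)).fun_add
      (hMx 0 1)).const_mul t).const_mul _)]
  have hrelation := poissonMoment_relation hlam hf hfin ht hx.ne'
  field_simp at hrelation ⊢
  push_cast
  linear_combination t * poissonConst lam * hrelation

end Poisson

section LebesguePoint

variable {x δ ε ρ : ℝ} {s : Set ℝ} {f g : ℝ → ℝ}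

/-- `x` is a Lebesgue point of `f`: the mean of `|f - f x|` over small balls about `x` tends
to `0`. -/
def IsLebesguePoint (f : ℝ → ℝ) (x : ℝ) : Prop :=
  Tendsto (fun r => (∫⁻ y in Metric.closedBall x r, ‖f y - f x‖ₑ) / volume (Metric.closedBall x r))
    (𝓝[>] 0) (𝓝 0)

lemma eventually_closedBall_subset {U : Set ℝ} (hU : U ∈ 𝓝 x) :
    ∀ᶠ r in 𝓝[>] (0 : ℝ), Metric.closedBall x r ⊆ U := by
  obtain ⟨δ, hδ, hsub⟩ := Metric.nhds_basis_closedBall.mem_iff.1 hU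
  filter_upwards [Ioo_mem_nhdsGT hδ] with r hr
  exact (Metric.closedBall_subset_closedBall hr.2.le).trans hsub

lemma IsLebesguePoint.congr (hf : IsLebesguePoint f x) (h : f =ᶠ[𝓝 x] g) :
    IsLebesguePoint g x := by
  refine Tendsto.congr' ?_ hf
  filter_upwards [eventually_closedBall_subset h] with r hr
  rw [setLIntegral_congr_fun measurableSet_closedBall fun y hy => ?_]
  rw [hr hy, h.self_of_nhds]

lemma ae_isLebesguePoint (hf : LocallyIntegrable f) : ∀ᵐ x, IsLebesguePoint f x := by
  filter_upwards [(Besicovitch.vitaliFamily volume).ae_tendsto_lintegral_enorm_sub_div hf] with x hx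
  exact hx.comp (Besicovitch.tendsto_filterAt volume x)

lemma ae_restrict_isLebesguePoint (hs : IsOpen s) (hf : LocallyIntegrableOn f s) :
    ∀ᵐ x ∂volume.restrict s, IsLebesguePoint f x := by
  obtain ⟨u, hu, hsu, hfu⟩ := hf.exists_nat_integrableOn
  have hae := ae_all_iff.2 fun n => ae_isLebesguePoint
    ((integrable_indicator_iff ((hu n).inter hs).measurableSet).2 (hfu n)).locallyIntegrable
  rw [ae_restrict_iff' hs.measurableSet]
  filter_upwards [hae] with x hx hxs
  obtain ⟨n, hn⟩ := mem_iUnion.1 (hsu hxs)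
  refine (hx n).congr ?_
  filter_upwards [((hu n).inter hs).mem_nhds ⟨hn, hxs⟩] with y hy
  exact indicator_of_mem hy f

lemma IsLebesguePoint.exists_closedBall (hf : IsLebesguePoint f x) {U : Set ℝ} (hU : U ∈ 𝓝 x)
    (hε : 0 < ε) :
    ∃ δ > 0, Metric.closedBall x δ ⊆ U ∧ ∀ r, 0 < r → r ≤ δ →
      ∫⁻ y in Metric.closedBall x r, ‖f y - f x‖ₑ ≤ ENNReal.ofReal (ε * r) := by
  have hmean := (hf : Tendsto _ _ _).eventually
    (gt_mem_nhds (ENNReal.ofReal_pos.2 (half_pos hε)))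
  obtain ⟨δ, hδ, hball⟩ := mem_nhdsGT_iff_exists_Ioc_subset.1
    (hmean.and (eventually_closedBall_subset hU))
  refine ⟨δ, hδ, (hball ⟨hδ, le_rfl⟩).2, fun r hr hrδ => ?_⟩
  have hle := (hball ⟨hr, hrδ⟩).1.le
  rwa [Real.volume_closedBall, ENNReal.div_le_iff (by simpa using hr) ENNReal.ofReal_ne_top,
    ← ENNReal.ofReal_mul (by positivity), show ε / 2 * (2 * r) = ε * r by ring] at hle

lemma exists_div_sq_add_sq_le_geometric (hρ : 0 < ρ) (r : ℝ) :
    ∃ k : ℕ, r ≤ 2 ^ k * ρ ∧ ρ / (ρ ^ 2 + r ^ 2) ≤ 4 / ρ * (1 / 4) ^ k := by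
  have hex : ∃ k : ℕ, r ≤ 2 ^ k * ρ := by
    obtain ⟨k, hk⟩ := pow_unbounded_of_one_lt (r / ρ) one_lt_two
    exact ⟨k, ((div_lt_iff₀ hρ).1 hk).le⟩
  classical
  refine ⟨Nat.find hex, Nat.find_spec hex, ?_⟩
  rcases hk : Nat.find hex with _ | k
  · rw [pow_zero, mul_one, div_le_div_iff₀ (by positivity) hρ]
    nlinarith [sq_nonneg r, sq_nonneg ρ]
  · have hr : 2 ^ k * ρ < r := not_le.1 (Nat.find_min hex (m := k) (by omega))
    have hsq : (2 ^ k * ρ) ^ 2 ≤ ρ ^ 2 + r ^ 2 :=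
      (pow_le_pow_left₀ (by positivity) hr.le 2).trans (le_add_of_nonneg_left (sq_nonneg ρ))
    calc ρ / (ρ ^ 2 + r ^ 2) ≤ ρ / (2 ^ k * ρ) ^ 2 := by gcongr
      _ = 4 / ρ * (1 / 4) ^ (k + 1) := by
          rw [mul_pow, ← pow_mul, mul_comm k, pow_mul, one_div, inv_pow]
          field_simp
          norm_num [pow_succ]

lemma ofReal_div_sq_add_sq_mul_le_tsum (hρ : 0 < ρ) (x y : ℝ) (c : ENNReal) :
    ENNReal.ofReal (ρ / (ρ ^ 2 + (y - x) ^ 2)) * c ≤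
      ∑' k : ℕ, (Metric.closedBall x (2 ^ k * ρ)).indicator
        (fun _ => ENNReal.ofReal (4 / ρ * (1 / 4) ^ k) * c) y := by
  obtain ⟨k, hk, hle⟩ := exists_div_sq_add_sq_le_geometric hρ |y - x|
  refine le_trans ?_ (ENNReal.le_tsum k)
  rw [indicator_of_mem (Metric.mem_closedBall.2 hk), ← sq_abs (y - x)]
  gcongr

lemma lintegral_div_sq_add_sq_mul_le {g : ℝ → ENNReal} (hρ : 0 < ρ) (hε : 0 ≤ ε) (hδ : 0 < δ)
    (hg : AEMeasurable g (volume.restrict (Metric.closedBall x δ)))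
    (hmean : ∀ r, 0 < r → r ≤ δ →
      ∫⁻ y in Metric.closedBall x r, g y ≤ ENNReal.ofReal (ε * r)) :
    ∫⁻ y in Metric.closedBall x δ, ENNReal.ofReal (ρ / (ρ ^ 2 + (y - x) ^ 2)) * g y ≤
      ENNReal.ofReal (8 * ε) := by
  have hshell : ∀ k : ℕ, ∫⁻ y in Metric.closedBall x δ, (Metric.closedBall x (2 ^ k * ρ)).indicator
      (fun y => ENNReal.ofReal (4 / ρ * (1 / 4) ^ k) * g y) y ≤
        ENNReal.ofReal (4 * ε * (1 / 2) ^ k) := fun k => by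
    have hpos : 0 < min (2 ^ k * ρ) δ := lt_min (by positivity) hδ
    have hpow : (1 / 4 : ℝ) ^ k * 2 ^ k = (1 / 2) ^ k := by rw [← mul_pow]; norm_num
    rw [setLIntegral_indicator measurableSet_closedBall,
      lintegral_const_mul' _ _ ENNReal.ofReal_ne_top]
    calc ENNReal.ofReal (4 / ρ * (1 / 4) ^ k) *
          ∫⁻ y in Metric.closedBall x (2 ^ k * ρ) ∩ Metric.closedBall x δ, g y
        ≤ ENNReal.ofReal (4 / ρ * (1 / 4) ^ k) *
          ∫⁻ y in Metric.closedBall x (min (2 ^ k * ρ) δ), g y := by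
          gcongr
          exact fun y hy => Metric.mem_closedBall.2 (le_min hy.1 hy.2)
      _ ≤ ENNReal.ofReal (4 / ρ * (1 / 4) ^ k) * ENNReal.ofReal (ε * (2 ^ k * ρ)) := by
          gcongr
          exact (hmean _ hpos (min_le_right _ _)).trans (by gcongr; exact min_le_left _ _)
      _ = _ := by
          rw [← ENNReal.ofReal_mul (by positivity), ← hpow]
          congr 1
          field_simp
  calc ∫⁻ y in Metric.closedBall x δ, ENNReal.ofReal (ρ / (ρ ^ 2 + (y - x) ^ 2)) * g y
      ≤ ∫⁻ y in Metric.closedBall x δ, ∑' k : ℕ, (Metric.closedBall x (2 ^ k * ρ)).indicator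
          (fun y => ENNReal.ofReal (4 / ρ * (1 / 4) ^ k) * g y) y :=
        lintegral_mono fun y => ofReal_div_sq_add_sq_mul_le_tsum hρ x y (g y)
    _ ≤ ∑' k : ℕ, ENNReal.ofReal (4 * ε * (1 / 2) ^ k) := by
        rw [lintegral_tsum fun k => (hg.const_mul _).indicator measurableSet_closedBall]
        exact ENNReal.tsum_le_tsum hshell
    _ = ENNReal.ofReal (8 * ε) := by
        rw [← ENNReal.ofReal_tsum_of_nonneg (fun k => by positivity)
          (summable_geometric_two.mul_left _), tsum_mul_left, tsum_geometric_two]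
        ring_nf

lemma norm_integral_closedBall_le {F : ℝ → ℝ} {C : ℝ} (hρ : 0 < ρ) (hε : 0 ≤ ε) (hδ : 0 < δ)
    (hC : 0 ≤ C) (hg : AEMeasurable g (volume.restrict (Metric.closedBall x δ)))
    (hF : ∀ y ∈ Metric.closedBall x δ, ‖F y‖ ≤ C * (ρ / (ρ ^ 2 + (y - x) ^ 2)) * ‖g y‖)
    (hmean : ∀ r, 0 < r → r ≤ δ →
      ∫⁻ y in Metric.closedBall x r, ‖g y‖ₑ ≤ ENNReal.ofReal (ε * r)) :
    ‖∫ y in Metric.closedBall x δ, F y‖ ≤ 8 * C * ε := by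
  refine (norm_integral_le_lintegral_norm F).trans (ENNReal.toReal_le_of_le_ofReal
    (by positivity) ?_)
  calc ∫⁻ y in Metric.closedBall x δ, ENNReal.ofReal ‖F y‖
      ≤ ∫⁻ y in Metric.closedBall x δ,
          ENNReal.ofReal C * (ENNReal.ofReal (ρ / (ρ ^ 2 + (y - x) ^ 2)) * ‖g y‖ₑ) := by
        refine setLIntegral_mono' measurableSet_closedBall fun y hy => ?_
        rw [← ofReal_norm (g y), ← mul_assoc, ← ENNReal.ofReal_mul hC,
          ← ENNReal.ofReal_mul (by positivity)]
        exact ENNReal.ofReal_le_ofReal (hF y hy)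
    _ ≤ ENNReal.ofReal C * ENNReal.ofReal (8 * ε) := by
        rw [lintegral_const_mul' _ _ ENNReal.ofReal_ne_top]
        gcongr
        exact lintegral_div_sq_add_sq_mul_le hρ hε hδ hg.enorm hmean
    _ = ENNReal.ofReal (8 * C * ε) := by
        rw [← ENNReal.ofReal_mul hC]
        ring_nf

lemma integrableOn_mul_norm_sub {φ : ℝ → ℝ} (hφ : IntegrableOn φ s)
    (hf : AEMeasurable f (volume.restrict s)) (hφf : IntegrableOn (fun y => φ y * |f y|) s)
    (c : ℝ) : IntegrableOn (fun y => φ y * ‖f y - c‖) s := by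
  refine Integrable.mono' (hφf.norm.fun_add (hφ.norm.mul_const |c|))
    (hφ.aestronglyMeasurable.mul (hf.sub_const _).norm.aestronglyMeasurable)
    (ae_of_all _ fun y => ?_)
  simp only [norm_mul, norm_eq_abs, abs_abs]
  rw [← mul_add]
  gcongr
  exact abs_sub _ _

lemma norm_setIntegral_mul_le_of_norm_le {F φ : ℝ → ℝ} {η : ℝ} (hs : MeasurableSet s)
    (hg : IntegrableOn (fun y => φ y * ‖g y‖) s) (hF : ∀ y ∈ s, ‖F y‖ ≤ η * φ y) :
    ‖∫ y in s, F y * g y‖ ≤ η * ∫ y in s, φ y * ‖g y‖ := by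
  rw [← integral_const_mul]
  refine norm_integral_le_of_norm_le (hg.const_mul _) ?_
  filter_upwards [ae_restrict_mem hs] with y hy
  rw [norm_mul, ← mul_assoc]
  exact mul_le_mul_of_nonneg_right (hF y hy) (norm_nonneg _)

theorem tendsto_setIntegral_mul_of_isLebesguePoint {ι : Type*} {l : Filter ι} {U : Set ℝ} {C : ℝ}
    {H : ι → ℝ → ℝ} {φ : ℝ → ℝ} {ρ : ι → ℝ} (hs : MeasurableSet s) (hsx : s ∈ 𝓝 x) (hU : U ∈ 𝓝 x)
    (hf : AEMeasurable f (volume.restrict s)) (hfx : IsLebesguePoint f x)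
    (hφ : IntegrableOn φ s) (hφf : IntegrableOn (fun y => φ y * |f y|) s)
    (hH : ∀ᶠ t in l, ∫ y in s, H t y = 1) (hHf : ∀ᶠ t in l, IntegrableOn (fun y => H t y * f y) s)
    (hC : 0 < C) (hρ : ∀ᶠ t in l, 0 < ρ t)
    (hnear : ∀ᶠ t in l, ∀ y ∈ U, ‖H t y‖ ≤ C * (ρ t / (ρ t ^ 2 + (y - x) ^ 2)))
    (hfar : ∀ δ > 0, ∃ η : ι → ℝ, Tendsto η l (𝓝 0) ∧
      ∀ᶠ t in l, ∀ y ∈ s, δ ≤ |y - x| → ‖H t y‖ ≤ η t * φ y) :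
    Tendsto (fun t => ∫ y in s, H t y * f y) l (𝓝 (f x)) := by
  rw [Metric.tendsto_nhds]
  intro ε hε
  obtain ⟨δ, hδ, hball, hmean⟩ := hfx.exists_closedBall (inter_mem hsx hU)
    (by positivity : 0 < ε / (16 * C))
  rw [subset_inter_iff] at hball
  set B := Metric.closedBall x δ
  obtain ⟨η, hη, hηle⟩ := hfar δ hδ
  have hsmall := (hη.mul_const (∫ y in s \ B, φ y * ‖f y - f x‖)).eventually
    (gt_mem_nhds ((zero_mul _).trans_lt (half_pos hε)))
  filter_upwards [hH, hHf, hρ, hnear, hηle, hsmall] with t hH hHf hρ hnear hηle hsmall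
  have hHI : IntegrableOn (H t) s := .of_integral_ne_zero (by rw [hH]; exact one_ne_zero)
  have hI : IntegrableOn (fun y => H t y * (f y - f x)) s := by
    simp only [mul_sub]
    exact hHf.sub (hHI.mul_const (f x))
  have hsplit : (∫ y in s, H t y * f y) - f x =
      (∫ y in B, H t y * (f y - f x)) + ∫ y in s \ B, H t y * (f y - f x) := by
    rw [← inter_eq_self_of_subset_right hball.1, sdiff_self_inter,
      integral_inter_add_sdiff measurableSet_closedBall hI]
    simp only [mul_sub]
    rw [integral_sub hHf (hHI.mul_const (f x)), integral_mul_const, hH, one_mul]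
  have hB : ‖∫ y in B, H t y * (f y - f x)‖ ≤ 8 * C * (ε / (16 * C)) := by
    refine norm_integral_closedBall_le hρ (by positivity) hδ hC.le
      ((hf.mono_measure (Measure.restrict_mono hball.1 le_rfl)).sub_const _) (fun y hy => ?_) hmean
    rw [norm_mul]
    gcongr
    exact hnear y (hball.2 hy)
  have hsB : ‖∫ y in s \ B, H t y * (f y - f x)‖ ≤
      η t * ∫ y in s \ B, φ y * ‖f y - f x‖ :=
    norm_setIntegral_mul_le_of_norm_le (hs.diff measurableSet_closedBall)
      ((integrableOn_mul_norm_sub hφ hf hφf _).mono_set sdiff_subset)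
      fun y hy => hηle y hy.1 (not_le.1 hy.2).le
  rw [dist_eq_norm, hsplit]
  calc _ ≤ _ := norm_add_le _ _
    _ < 8 * C * (ε / (16 * C)) + ε / 2 := add_lt_add_of_le_of_lt hB (hsB.trans_lt hsmall)
    _ = ε := by field_simp; norm_num

end LebesguePoint

lemma FiniteAgainst.locallyIntegrableOn {φ f : ℝ → ℝ} (h : FiniteAgainst φ f) (hφ : Measurable φ)
    (hφc : ContinuousOn φ (Ioi 0)) (hφ0 : ∀ y, 0 < y → 0 < φ y)
    (hf : AEMeasurable f (volume.restrict (Ioi (0 : ℝ)))) : LocallyIntegrableOn f (Ioi 0) := by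
  have hφf : IntegrableOn (fun y => φ y * f y) (Ioi 0) := by
    refine (h.integrableOn hφ (fun y hy => (hφ0 y hy).le) hf).mono'
      (hφ.aemeasurable.mul hf).aestronglyMeasurable ?_
    filter_upwards [ae_restrict_mem measurableSet_Ioi] with y (hy : 0 < y)
    rw [norm_mul, norm_of_nonneg (hφ0 y hy).le, norm_eq_abs]
  refine (hφf.locallyIntegrableOn.continuousOn_mul (hφc.inv₀ fun y hy => (hφ0 y hy).ne')
    isOpen_Ioi.isLocallyClosed).congr ?_
  filter_upwards [ae_restrict_mem measurableSet_Ioi] with y (hy : 0 < y)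
  exact inv_mul_cancel_left₀ (hφ0 y hy).ne' _

section HeatMass

variable {lam b p t x : ℝ}

/-- The density on `(0, ∞)` of the square root of a Gamma variable of shape `p` and rate `b`
(the Nakagami density). -/
def nakagamiDensity (b p y : ℝ) : ℝ :=
  2 * b ^ p / Gamma p * (y ^ (2 * p - 1) * exp (-b * y ^ (2 : ℝ)))

lemma nakagamiDensity_nonneg {y : ℝ} (hb : 0 < b) (hp : 0 < p) (hy : 0 < y) :
    0 ≤ nakagamiDensity b p y := by
  have := Gamma_pos_of_pos hp
  unfold nakagamiDensity
  positivity

lemma integral_nakagamiDensity (hb : 0 < b) (hp : 0 < p) :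
    ∫ y in Ioi (0 : ℝ), nakagamiDensity b p y = 1 := by
  have := Gamma_pos_of_pos hp
  simp only [nakagamiDensity]
  rw [integral_const_mul, integral_rpow_mul_exp_neg_mul_rpow two_pos (by linarith) hb,
    show (2 * p - 1 + 1) / 2 = p by ring, show -(2 * p - 1 + 1) / 2 = -p by ring, rpow_neg hb.le]
  field_simp

lemma heatKernel_mul_rpow_eq_tsum {y : ℝ} (hlam : 0 ≤ lam) (ht : 0 < t) (hx : 0 < x) (hy : 0 < y) :
    heatKernel lam t x y * y ^ (2 * lam) =
      ∑' k : ℕ, exp (-(x ^ 2 / (4 * t))) * (x ^ 2 / (4 * t)) ^ k / k.factorial *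
        nakagamiDensity (1 / (4 * t)) (k + (lam + 1 / 2)) y := by
  rw [heatKernel, besselI, ← tsum_mul_left, ← tsum_mul_right]
  refine tsum_congr fun k => ?_
  have : 0 < Gamma (k + (lam + 1 / 2)) := Gamma_pos_of_pos (by positivity)
  rw [nakagamiDensity, show (k : ℝ) + (lam - 1 / 2) + 1 = k + (lam + 1 / 2) by ring]
  have : (0 : ℝ) < k.factorial := by positivity
  refine log_injOn_pos (mem_Ioi.2 (by positivity)) (mem_Ioi.2 (by positivity)) ?_
  simp (disch := positivity) only [log_mul, log_div, log_rpow, log_pow, log_exp, log_one, rpow_two]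
  rw [show (4 : ℝ) = 2 ^ 2 by norm_num, log_pow]
  field_simp
  push_cast
  ring

/-- The heat kernel is a Poisson mixture of probability densities. -/
lemma integral_heatKernel (hlam : 0 ≤ lam) (ht : 0 < t) (hx : 0 < x) :
    ∫ y in Ioi (0 : ℝ), heatKernel lam t x y * y ^ (2 * lam) = 1 := by
  have ha : 0 ≤ x ^ 2 / (4 * t) := by positivity
  have hb : 0 < 1 / (4 * t) := by positivity
  have hp : ∀ k : ℕ, 0 < k + (lam + 1 / 2) := fun k => by positivity
  set w : ℕ → ℝ := fun k => exp (-(x ^ 2 / (4 * t))) * (x ^ 2 / (4 * t)) ^ k / k.factorial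
  have hw : HasSum w 1 := ProbabilityTheory.hasSum_one_poissonMeasure ⟨_, ha⟩
  set d : ℕ → ℝ → ℝ := fun k => nakagamiDensity (1 / (4 * t)) (k + (lam + 1 / 2))
  have hd : ∀ k, ∫ y in Ioi 0, d k y = 1 := fun k => integral_nakagamiDensity hb (hp k)
  have hmass : ∀ k, ∫ y in Ioi 0, w k * d k y = w k := fun k => by
    rw [integral_const_mul, hd, mul_one]
  have hnorm : ∀ k, ∫ y in Ioi 0, ‖w k * d k y‖ = w k := fun k => by
    refine (setIntegral_congr_fun measurableSet_Ioi fun y (hy : 0 < y) =>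
      norm_of_nonneg ?_).trans (hmass k)
    exact mul_nonneg (by positivity) (nakagamiDensity_nonneg hb (hp k) hy)
  rw [setIntegral_congr_fun measurableSet_Ioi fun y hy =>
      heatKernel_mul_rpow_eq_tsum hlam ht hx hy,
    ← integral_tsum_of_summable_integral_norm, tsum_congr hmass, hw.tsum_eq]
  · exact fun k => (Integrable.of_integral_ne_zero (by rw [hd]; exact one_ne_zero)).const_mul _
  · exact (summable_congr hnorm).2 hw.summable

end HeatMass

section HeatBounds

variable {lam t x y : ℝ}

lemma one_le_integral_exp_angularMeasure (z : ℝ) : 1 ≤ ∫ s, exp (z * s) ∂angularMeasure lam := by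
  have hmean : ∫ s, s ∂angularMeasure lam = 0 := by
    simpa using integral_pow_odd_angularMeasure (lam := lam) 0
  have hInt : Integrable (fun s => z * s) (angularMeasure lam) :=
    integrable_angularMeasure_of_continuous (by fun_prop)
  calc 1 = ∫ s, (z * s + 1) ∂angularMeasure lam := by
        rw [integral_add hInt (integrable_const _), integral_const_mul, hmean]
        simp
    _ ≤ ∫ s, exp (z * s) ∂angularMeasure lam :=
        integral_mono (hInt.add (integrable_const _))
          (integrable_angularMeasure_of_continuous (by fun_prop)) fun s => add_one_le_exp _

lemma le_heatKernel (hlam : 0 ≤ lam) (ht : 0 < t) (hx : 0 < x) (hy : 0 < y) :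
    heatConst lam * t ^ (-(lam + 1 / 2)) * exp (-(x ^ 2 + y ^ 2) / (4 * t)) ≤
      heatKernel lam t x y := by
  have := heatConst_pos hlam
  rw [heatKernel_eq_integral_exp hlam ht hx hy]
  gcongr
  exact le_mul_of_one_le_right (exp_nonneg _) (one_le_integral_exp_angularMeasure _)

lemma heatKernel_pos (hlam : 0 ≤ lam) (ht : 0 < t) (hx : 0 < x) (hy : 0 < y) :
    0 < heatKernel lam t x y := by
  have := heatConst_pos hlam
  exact lt_of_lt_of_le (by positivity) (le_heatKernel hlam ht hx hy)

lemma heatKernel_le (hlam : 0 ≤ lam) (ht : 0 < t) (hx : 0 < x) (hy : 0 < y) :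
    heatKernel lam t x y ≤
      heatConst lam * t ^ (-(lam + 1 / 2)) * exp (-(y - x) ^ 2 / (4 * t)) := by
  have := heatConst_pos hlam
  rw [heatKernel_eq_integral_gaussian hlam ht hx hy]
  gcongr
  calc _ ≤ ∫ _, exp (-(y - x) ^ 2 / (4 * t)) ∂angularMeasure lam := by
        refine integral_mono_ae (integrable_angularMeasure_of_continuous (by fun_prop))
          (integrable_const _) ?_
        filter_upwards [ae_abs_le_one_angularMeasure] with s hs
        have : 0 ≤ x * y * (1 - s) :=
          mul_nonneg (by positivity) (sub_nonneg.2 ((le_abs_self s).trans hs))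
        gcongr
        linarith
    _ = _ := by simp

lemma rpow_neg_mul_rpow_le (hlam : 0 ≤ lam) (ht : 0 < t) (hx : 0 < x) (hy : 0 < y)
    (hyx : y ≤ 2 * x) : (x * y / (2 * t)) ^ (-lam) * y ^ (2 * lam) ≤ (4 * t) ^ lam := by
  rw [rpow_neg (by positivity), ← inv_rpow (by positivity), rpow_mul hy.le,
    ← mul_rpow (by positivity) (by positivity), rpow_two]
  refine rpow_le_rpow (by positivity) ?_ hlam
  rw [inv_div, div_mul_eq_mul_div, div_le_iff₀ (by positivity)]
  nlinarith [mul_le_mul_of_nonneg_left hyx (mul_pos ht hy).le]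

lemma rpow_neg_half_mul_exp_le (ht : 0 < t) (r : ℝ) :
    t ^ (-(1 / 2) : ℝ) * exp (-r ^ 2 / (4 * t)) ≤ 4 * (√t / (√t ^ 2 + r ^ 2)) := by
  have hexp : exp (-r ^ 2 / (4 * t)) ≤ 4 * t / (t + r ^ 2) := by
    rw [neg_div, exp_neg, inv_le_comm₀ (exp_pos _) (by positivity), inv_div]
    refine le_trans ?_ (add_one_le_exp _)
    rw [div_le_iff₀ (by positivity), add_mul, div_mul_cancel₀ _ (by positivity)]
    linarith [sq_nonneg r]
  have hsqrt : t ^ (-(1 / 2) : ℝ) * t = √t := by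
    rw [← rpow_add_one ht.ne', sqrt_eq_rpow]
    norm_num
  calc t ^ (-(1 / 2) : ℝ) * exp (-r ^ 2 / (4 * t))
      ≤ t ^ (-(1 / 2) : ℝ) * (4 * t / (t + r ^ 2)) := by gcongr
    _ = 4 * (t ^ (-(1 / 2) : ℝ) * t / (t + r ^ 2)) := by ring
    _ = _ := by rw [hsqrt, sq_sqrt ht.le]

lemma exists_heatKernel_mul_rpow_le_gaussian (hlam : 0 ≤ lam) :
    ∃ C > 0, ∀ t x y, 0 < t → 0 < x → 0 < y → y ≤ 2 * x →
      heatKernel lam t x y * y ^ (2 * lam) ≤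
        C * (t ^ (-(1 / 2) : ℝ) * exp (-(y - x) ^ 2 / (4 * t))) := by
  obtain ⟨C, hC, hle⟩ := exists_integral_exp_angularMeasure_le hlam
  have hc := heatConst_pos hlam
  refine ⟨heatConst lam * C * 4 ^ lam, by positivity, fun t x y ht hx hy hyx => ?_⟩
  have hexp : exp (-(x ^ 2 + y ^ 2) / (4 * t)) * exp (x * y / (2 * t)) =
      exp (-(y - x) ^ 2 / (4 * t)) := by
    rw [← exp_add]
    congr 1
    field_simp
    ring
  have hpow : t ^ (-(lam + 1 / 2)) * (4 * t) ^ lam = 4 ^ lam * t ^ (-(1 / 2) : ℝ) := by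
    rw [mul_rpow (by norm_num) ht.le, mul_left_comm, ← rpow_add ht]
    ring_nf
  rw [heatKernel_eq_integral_exp hlam ht hx hy]
  calc _ ≤ heatConst lam * t ^ (-(lam + 1 / 2)) * (exp (-(x ^ 2 + y ^ 2) / (4 * t)) *
        (C * ((x * y / (2 * t)) ^ (-lam) * exp (x * y / (2 * t))))) * y ^ (2 * lam) := by
        gcongr
        exact hle _ (by positivity)
    _ = heatConst lam * C * t ^ (-(lam + 1 / 2)) * (exp (-(x ^ 2 + y ^ 2) / (4 * t)) *
          exp (x * y / (2 * t))) * ((x * y / (2 * t)) ^ (-lam) * y ^ (2 * lam)) := by ring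
    _ ≤ heatConst lam * C * t ^ (-(lam + 1 / 2)) * (exp (-(x ^ 2 + y ^ 2) / (4 * t)) *
          exp (x * y / (2 * t))) * (4 * t) ^ lam := by
        gcongr
        exact rpow_neg_mul_rpow_le hlam ht hx hy hyx
    _ = _ := by
        rw [hexp]
        linear_combination heatConst lam * C * exp (-(y - x) ^ 2 / (4 * t)) * hpow

lemma exists_heatKernel_mul_rpow_le_cauchy (hlam : 0 ≤ lam) :
    ∃ C > 0, ∀ t x y, 0 < t → 0 < x → 0 < y → y ≤ 2 * x →
      heatKernel lam t x y * y ^ (2 * lam) ≤ C * (√t / (√t ^ 2 + (y - x) ^ 2)) := by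
  obtain ⟨C, hC, hle⟩ := exists_heatKernel_mul_rpow_le_gaussian hlam
  refine ⟨C * 4, by positivity, fun t x y ht hx hy hyx => ?_⟩
  rw [mul_assoc]
  exact (hle t x y ht hx hy hyx).trans
    (mul_le_mul_of_nonneg_left (rpow_neg_half_mul_exp_le ht _) hC.le)

end HeatBounds

section HeatBoundary

variable {lam t t₀ x : ℝ} {f : ℝ → ℝ}

lemma continuousOn_heatFactor (lam t : ℝ) : ContinuousOn (heatFactor lam t) (Ioi 0) := by
  unfold heatFactor
  refine ((continuousOn_id.rpow_const fun y (hy : 0 < y) => Or.inl hy.ne').mul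
    (ContinuousOn.rpow_const ?_ fun y (hy : 0 < y) => Or.inl (by positivity))).mul (by fun_prop)
  exact continuousOn_id.div (by fun_prop) fun y (hy : 0 < y) => by positivity

lemma integrableOn_heatFactor (hlam : 0 ≤ lam) (ht : 0 < t) :
    IntegrableOn (heatFactor lam t) (Ioi 0) := by
  refine (integrable_rpow_mul_exp_neg_mul_sq (b := 1 / (4 * t)) (by positivity)
    (by linarith : -1 < 2 * lam)).integrableOn.mono'
    (measurable_heatFactor lam t).aestronglyMeasurable ?_
  filter_upwards [ae_restrict_mem measurableSet_Ioi] with y (hy : 0 < y)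
  rw [norm_of_nonneg (heatFactor_pos hy).le, heatFactor_eq hy,
    show -(1 / (4 * t)) * y ^ 2 = -y ^ 2 / (4 * t) by ring]
  gcongr
  exact mul_le_of_le_one_right (by positivity)
    (rpow_le_one_of_one_le_of_nonpos (by linarith) (by linarith))

lemma tendsto_rpow_neg_mul_exp_neg_div (p : ℝ) {c : ℝ} (hc : 0 < c) :
    Tendsto (fun t : ℝ => t ^ (-p) * exp (-c / t)) (𝓝[>] 0) (𝓝 0) := by
  refine ((tendsto_rpow_mul_exp_neg_mul_atTop_nhds_zero p c hc).comp
    tendsto_inv_nhdsGT_zero).congr' ?_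
  filter_upwards [self_mem_nhdsWithin] with t (ht : 0 < t)
  rw [Function.comp_apply, inv_rpow ht.le, rpow_neg ht.le, div_eq_mul_inv]

lemma exp_neg_sub_sq_div_le {δ y : ℝ} (ht : 0 < t) (htt₀ : t ≤ t₀ / 8) (hδ : 0 ≤ δ)
    (hy : δ ≤ |y - x|) : exp (-(y - x) ^ 2 / (4 * t)) ≤
      exp (-(δ ^ 2 / 8) / t) * exp (-y ^ 2 * (1 / t₀) + y * (2 * x / t₀)) := by
  have ht₀ : 0 < t₀ := by linarith
  have hhalf : -(y - x) ^ 2 / (4 * t) = -((y - x) ^ 2 / 8) / t + -((y - x) ^ 2 / (8 * t)) := by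
    field_simp
    ring
  have hδle : δ ^ 2 ≤ (y - x) ^ 2 := by
    rw [← sq_abs (y - x)]
    gcongr
  have htime : (y - x) ^ 2 / t₀ ≤ (y - x) ^ 2 / (8 * t) := by
    gcongr
    linarith
  have hexpand : -y ^ 2 * (1 / t₀) + y * (2 * x / t₀) = x ^ 2 / t₀ + -((y - x) ^ 2 / t₀) := by
    ring
  rw [← exp_add, exp_le_exp, hhalf, hexpand]
  have : 0 ≤ x ^ 2 / t₀ := by positivity
  refine add_le_add (by gcongr) (by linarith)

lemma exists_heatKernel_mul_rpow_le_heatFactor (hlam : 0 ≤ lam) (hx : 0 < x) (ht₀ : 0 < t₀)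
    {δ : ℝ} (hδ : 0 < δ) :
    ∃ η : ℝ → ℝ, Tendsto η (𝓝[>] 0) (𝓝 0) ∧ ∀ᶠ t in 𝓝[>] 0, ∀ y, 0 < y → δ ≤ |y - x| →
      heatKernel lam t x y * y ^ (2 * lam) ≤ η t * heatFactor lam t₀ y := by
  obtain ⟨C, hC⟩ := exists_exp_mul_rpow_le_heatFactor hlam
    (t := t₀) (α := 1 / t₀) (one_div_lt_one_div_of_lt ht₀ (by linarith)) (2 * x / t₀)
  have hc := heatConst_pos hlam
  refine ⟨fun t => heatConst lam * C * (t ^ (-(lam + 1 / 2)) * exp (-(δ ^ 2 / 8) / t)), ?_, ?_⟩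
  · simpa using (tendsto_rpow_neg_mul_exp_neg_div (lam + 1 / 2)
      (by positivity : 0 < δ ^ 2 / 8)).const_mul (heatConst lam * C)
  · filter_upwards [Ioo_mem_nhdsGT (by positivity : 0 < t₀ / 8)] with t ⟨ht, htt₀⟩ y hy hyδ
    calc heatKernel lam t x y * y ^ (2 * lam)
        ≤ heatConst lam * t ^ (-(lam + 1 / 2)) * (exp (-(δ ^ 2 / 8) / t) *
          exp (-y ^ 2 * (1 / t₀) + y * (2 * x / t₀))) * y ^ (2 * lam) := by
          gcongr
          refine (heatKernel_le hlam ht hx hy).trans ?_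
          gcongr
          exact exp_neg_sub_sq_div_le ht htt₀.le hδ.le hyδ
      _ = heatConst lam * t ^ (-(lam + 1 / 2)) * exp (-(δ ^ 2 / 8) / t) *
          (exp (-y ^ 2 * (1 / t₀) + y * (2 * x / t₀)) * y ^ (2 * lam)) := by ring
      _ ≤ heatConst lam * t ^ (-(lam + 1 / 2)) * exp (-(δ ^ 2 / 8) / t) *
          (C * heatFactor lam t₀ y) :=
          mul_le_mul_of_nonneg_left (hC y hy) (by positivity)
      _ = _ := by ring

theorem ae_tendsto_heatIntegral (hlam : 0 ≤ lam)
    (hf : AEMeasurable f (volume.restrict (Ioi (0 : ℝ)))) (ht₀ : 0 < t₀)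
    (hfin : FiniteAgainst (heatFactor lam t₀) f) :
    ∀ᵐ x ∂volume.restrict (Ioi (0 : ℝ)),
      Tendsto (fun t => heatIntegral lam f t x) (𝓝[>] 0) (𝓝 (f x)) := by
  have hloc : LocallyIntegrableOn f (Ioi 0) :=
    hfin.locallyIntegrableOn (measurable_heatFactor lam t₀) (continuousOn_heatFactor lam t₀)
      (fun y hy => heatFactor_pos hy) hf
  filter_upwards [ae_restrict_isLebesguePoint isOpen_Ioi hloc, ae_restrict_mem measurableSet_Ioi]
    with x hfx (hx : 0 < x)
  obtain ⟨C, hC, hnear⟩ := exists_heatKernel_mul_rpow_le_cauchy hlam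
  have hnorm : ∀ {t y : ℝ}, 0 < t → 0 < y →
      ‖heatKernel lam t x y * y ^ (2 * lam)‖ = heatKernel lam t x y * y ^ (2 * lam) :=
    fun ht hy => norm_of_nonneg
      (mul_nonneg (heatKernel_pos hlam ht hx hy).le (rpow_nonneg hy.le _))
  have hpos : ∀ᶠ t : ℝ in 𝓝[>] 0, 0 < t := self_mem_nhdsWithin
  suffices Tendsto (fun t => ∫ y in Ioi 0, heatKernel lam t x y * y ^ (2 * lam) * f y)
      (𝓝[>] 0) (𝓝 (f x)) by simpa only [heatIntegral, mul_right_comm _ (f _)] using this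
  refine tendsto_setIntegral_mul_of_isLebesguePoint (ρ := sqrt) (U := Ioo 0 (2 * x))
    (φ := heatFactor lam t₀) measurableSet_Ioi (Ioi_mem_nhds hx)
    (Ioo_mem_nhds hx (by linarith)) hf hfx (integrableOn_heatFactor hlam ht₀)
    (hfin.integrableOn (measurable_heatFactor lam t₀) (fun y hy => (heatFactor_pos hy).le) hf)
    ?_ ?_ hC (hpos.mono fun t => sqrt_pos.2) ?_ fun δ hδ => ?_
  · filter_upwards [hpos] with t ht using integral_heatKernel hlam ht hx
  · filter_upwards [Ioo_mem_nhdsGT ht₀] with t ht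
    simpa only [mul_right_comm _ (f _)] using integrableOn_heatKernel_mul hlam hf hfin ht.1 ht.2 hx
  · filter_upwards [hpos] with t ht y hy
    rw [hnorm ht hy.1]
    exact hnear t x y ht hx hy.1 hy.2.le
  · obtain ⟨η, hη, hle⟩ := exists_heatKernel_mul_rpow_le_heatFactor hlam hx ht₀ hδ
    refine ⟨η, hη, ?_⟩
    filter_upwards [hpos, hle] with t ht hle y hy hyδ
    rw [hnorm ht hy]
    exact hle y hy hyδ

end HeatBoundary

section PoissonMass

variable {lam t x : ℝ}

lemma aestronglyMeasurable_heatKernel (hlam : 0 ≤ lam) (hx : 0 < x) :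
    AEStronglyMeasurable (fun w : ℝ × ℝ => heatKernel lam w.2 x w.1)
      ((volume.restrict (Ioi (0 : ℝ))).prod (volume.restrict (Ioi (0 : ℝ)))) := by
  have hgauss : StronglyMeasurable fun w : ℝ × ℝ =>
      ∫ s, exp (-(x ^ 2 + w.1 ^ 2 - 2 * x * w.1 * s) / (4 * w.2)) ∂angularMeasure lam :=
    StronglyMeasurable.integral_prod_right'
      (f := fun v : (ℝ × ℝ) × ℝ =>
        exp (-(x ^ 2 + v.1.1 ^ 2 - 2 * x * v.1.1 * v.2) / (4 * v.1.2)))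
      (Measurable.stronglyMeasurable (by fun_prop))
  have hmeas : Measurable fun w : ℝ × ℝ => heatConst lam * w.2 ^ (-(lam + 1 / 2)) *
      ∫ s, exp (-(x ^ 2 + w.1 ^ 2 - 2 * x * w.1 * s) / (4 * w.2)) ∂angularMeasure lam :=
    Measurable.mul (by fun_prop) hgauss.measurable
  refine hmeas.aestronglyMeasurable.congr ?_
  filter_upwards [Measure.quasiMeasurePreserving_fst.ae (ae_restrict_mem measurableSet_Ioi),
    Measure.quasiMeasurePreserving_snd.ae (ae_restrict_mem measurableSet_Ioi)] with w hy hu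
  exact (heatKernel_eq_integral_gaussian hlam hu hx hy).symm

/-- The density on `(0, ∞)` of the law of the time `u` at which the heat semigroup is evaluated to
produce the Poisson semigroup at time `t` (the one-sided `1/2`-stable law). -/
def poissonSubordinator (t u : ℝ) : ℝ :=
  t / √(4 * π) * (u ^ (-(1 / 2 + 1) : ℝ) * exp (-t ^ 2 / (4 * u)))

lemma poissonSubordinator_nonneg {u : ℝ} (ht : 0 < t) (hu : 0 < u) :
    0 ≤ poissonSubordinator t u := by
  unfold poissonSubordinator
  positivity

lemma measurable_poissonSubordinator (t : ℝ) : Measurable (poissonSubordinator t) := by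
  unfold poissonSubordinator
  fun_prop

lemma integral_poissonSubordinator (ht : 0 < t) :
    ∫ u in Ioi (0 : ℝ), poissonSubordinator t u = 1 := by
  simp only [poissonSubordinator]
  rw [integral_const_mul, integral_rpow_mul_exp_neg_div (by norm_num) (by positivity),
    Gamma_one_half_eq, rpow_neg (by positivity), ← sqrt_eq_rpow, ← sqrt_eq_rpow, sqrt_sq ht.le,
    sqrt_mul (by norm_num)]
  have : √π ≠ 0 := by positivity
  field_simp

lemma poissonKernel_mul_rpow_eq_integral (lam t x y : ℝ) :
    poissonKernel lam t x y * y ^ (2 * lam) =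
      ∫ u in Ioi (0 : ℝ), poissonSubordinator t u * (heatKernel lam u x y * y ^ (2 * lam)) := by
  rw [poissonKernel, ← integral_const_mul, ← integral_mul_const]
  refine setIntegral_congr_fun measurableSet_Ioi fun u (hu : 0 < u) => ?_
  simp only [poissonSubordinator]
  rw [rpow_neg hu.le, show (1 / 2 + 1 : ℝ) = 3 / 2 by norm_num]
  ring

lemma integral_poissonKernel (hlam : 0 ≤ lam) (ht : 0 < t) (hx : 0 < x) :
    ∫ y in Ioi (0 : ℝ), poissonKernel lam t x y * y ^ (2 * lam) = 1 := by
  have hmass : ∀ u, 0 < u → ∫ y in Ioi (0 : ℝ),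
      poissonSubordinator t u * (heatKernel lam u x y * y ^ (2 * lam)) =
        poissonSubordinator t u := fun u hu => by
    rw [integral_const_mul, integral_heatKernel hlam hu hx, mul_one]
  have hInt : Integrable (Function.uncurry fun y u =>
      poissonSubordinator t u * (heatKernel lam u x y * y ^ (2 * lam)))
      ((volume.restrict (Ioi (0 : ℝ))).prod (volume.restrict (Ioi (0 : ℝ)))) := by
    rw [integrable_prod_iff']
    · constructor
      · filter_upwards [ae_restrict_mem measurableSet_Ioi] with u hu
        exact (Integrable.of_integral_ne_zero (by
          rw [integral_heatKernel hlam hu hx]; exact one_ne_zero)).const_mul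
            (poissonSubordinator t u)
      · refine (Integrable.of_integral_ne_zero
          (by rw [integral_poissonSubordinator ht]; exact one_ne_zero)).congr ?_
        filter_upwards [ae_restrict_mem measurableSet_Ioi] with u (hu : 0 < u)
        rw [← hmass u hu]
        refine setIntegral_congr_fun measurableSet_Ioi fun y (hy : 0 < y) =>
          (norm_of_nonneg ?_).symm
        exact mul_nonneg (poissonSubordinator_nonneg ht hu)
          (mul_nonneg (heatKernel_pos hlam hu hx hy).le (by positivity))
    · exact ((measurable_poissonSubordinator t).comp measurable_snd).aestronglyMeasurable.mul
        ((aestronglyMeasurable_heatKernel hlam hx).mul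
          (measurable_fst.pow_const _).aestronglyMeasurable)
  simp only [poissonKernel_mul_rpow_eq_integral]
  rw [integral_integral_swap hInt, setIntegral_congr_fun measurableSet_Ioi hmass,
    integral_poissonSubordinator ht]

end PoissonMass

section PoissonBounds

variable {lam t x y : ℝ}

lemma le_poissonKernel (hlam : 0 ≤ lam) (ht : 0 < t) (hx : 0 < x) (hy : 0 < y) :
    poissonConst lam * t * ((t ^ 2 + 2 * x ^ 2 + 2) * (y ^ 2 + 1)) ^ (-(lam + 1)) ≤
      poissonKernel lam t x y := by
  have := poissonConst_pos hlam
  have hbase : ∀ᵐ s ∂angularMeasure lam, t ^ 2 ≤ poissonBase (t ^ 2 + x ^ 2) x y s ∧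
      poissonBase (t ^ 2 + x ^ 2) x y s ≤ (t ^ 2 + 2 * x ^ 2 + 2) * (y ^ 2 + 1) := by
    filter_upwards [ae_abs_le_one_angularMeasure] with s hs
    refine ⟨by linarith [sq_sub_add_le_poissonBase (q := t ^ 2 + x ^ 2) hx hy hs,
      sq_nonneg (x - y)], ?_⟩
    unfold poissonBase
    nlinarith [(abs_le.1 hs).1, mul_pos hx hy, sq_nonneg (x - y), sq_nonneg (t * y),
      sq_nonneg (x * y)]
  rw [poissonKernel_eq_integral hlam ht hx hy]
  gcongr
  calc ((t ^ 2 + 2 * x ^ 2 + 2) * (y ^ 2 + 1)) ^ (-(lam + 1))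
      = ∫ _, ((t ^ 2 + 2 * x ^ 2 + 2) * (y ^ 2 + 1)) ^ (-(lam + 1)) ∂angularMeasure lam := by simp
    _ ≤ _ := by
      refine integral_mono_ae (integrable_const _) ?_ ?_
      · refine Integrable.of_bound (C := (t ^ 2) ^ (-(lam + 1)))
          (((measurable_poissonBase _ x).comp measurable_prodMk_left).pow_const
            _).aestronglyMeasurable ?_
        filter_upwards [hbase] with s hs
        rw [norm_of_nonneg (rpow_nonneg ((sq_nonneg t).trans hs.1) _)]
        exact rpow_le_rpow_of_nonpos (by positivity) hs.1 (by linarith)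
      · filter_upwards [hbase] with s hs
        exact rpow_le_rpow_of_nonpos (lt_of_lt_of_le (by positivity) hs.1) hs.2 (by linarith)

lemma poissonKernel_pos (hlam : 0 ≤ lam) (ht : 0 < t) (hx : 0 < x) (hy : 0 < y) :
    0 < poissonKernel lam t x y := by
  have := poissonConst_pos hlam
  exact lt_of_lt_of_le (by positivity) (le_poissonKernel hlam ht hx hy)

lemma poissonKernel_le (hlam : 0 ≤ lam) (ht : 0 < t) (hx : 0 < x) (hy : 0 < y) (hxy : x ≠ y) :
    poissonKernel lam t x y ≤ poissonConst lam * t * ((x - y) ^ 2) ^ (-(lam + 1)) := by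
  have := poissonConst_pos hlam
  have hpos : 0 < (x - y) ^ 2 := sq_pos_of_ne_zero (sub_ne_zero.2 hxy)
  have hbase : ∀ᵐ s ∂angularMeasure lam, (x - y) ^ 2 ≤ poissonBase (t ^ 2 + x ^ 2) x y s := by
    filter_upwards [ae_abs_le_one_angularMeasure] with s hs
    linarith [sq_sub_add_le_poissonBase (q := t ^ 2 + x ^ 2) hx hy hs, sq_nonneg t]
  rw [poissonKernel_eq_integral hlam ht hx hy]
  gcongr
  calc _ ≤ ∫ _, ((x - y) ^ 2) ^ (-(lam + 1)) ∂angularMeasure lam := by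
        refine integral_mono_of_nonneg (hbase.mono fun s hs => rpow_nonneg (hpos.le.trans hs) _)
          (integrable_const _) (hbase.mono fun s hs => ?_)
        exact rpow_le_rpow_of_nonpos hpos hs (by linarith)
    _ = _ := by simp

lemma exists_poissonKernel_mul_rpow_le_cauchy (hlam : 0 ≤ lam) :
    ∃ C > 0, ∀ t x y, 0 < t → 0 < x → 0 < y → y ≤ 2 * x →
      poissonKernel lam t x y * y ^ (2 * lam) ≤ C * (t / (t ^ 2 + (y - x) ^ 2)) := by
  obtain ⟨C, hC, hle⟩ := exists_heatKernel_mul_rpow_le_gaussian hlam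
  refine ⟨C * 4 / √(4 * π), by positivity, fun t x y ht hx hy hyx => ?_⟩
  have hD : 0 < t ^ 2 + (y - x) ^ 2 := by positivity
  have hmajorant : ∀ u, 0 < u → poissonSubordinator t u * (heatKernel lam u x y * y ^ (2 * lam)) ≤
      t / √(4 * π) * C *
        (u ^ (-(1 + 1) : ℝ) * exp (-(t ^ 2 + (y - x) ^ 2) / (4 * u))) := fun u hu => by
    have hpow : u ^ (-(1 + 1) : ℝ) = u ^ (-(1 / 2 + 1) : ℝ) * u ^ (-(1 / 2) : ℝ) := by
      rw [← rpow_add hu]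
      norm_num
    have hexp : exp (-(t ^ 2 + (y - x) ^ 2) / (4 * u)) =
        exp (-t ^ 2 / (4 * u)) * exp (-(y - x) ^ 2 / (4 * u)) := by
      rw [← exp_add]
      congr 1
      ring
    refine (mul_le_mul_of_nonneg_left (hle u x y hu hx hy hyx)
      (poissonSubordinator_nonneg ht hu)).trans_eq ?_
    rw [poissonSubordinator, hpow, hexp]
    ring
  rw [poissonKernel_mul_rpow_eq_integral]
  calc _ ≤ ∫ u in Ioi (0 : ℝ), t / √(4 * π) * C *
        (u ^ (-(1 + 1) : ℝ) * exp (-(t ^ 2 + (y - x) ^ 2) / (4 * u))) := by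
        refine integral_mono_of_nonneg ?_
          ((integrableOn_rpow_mul_exp_neg_div one_pos hD).const_mul _) ?_
        all_goals filter_upwards [ae_restrict_mem measurableSet_Ioi] with u (hu : 0 < u)
        · exact mul_nonneg (poissonSubordinator_nonneg ht hu)
            (mul_nonneg (heatKernel_pos hlam hu hx hy).le (by positivity))
        · exact hmajorant u hu
    _ = _ := by
        rw [integral_const_mul, integral_rpow_mul_exp_neg_div one_pos hD, Gamma_one, rpow_one,
          rpow_neg_one]
        field_simp

end PoissonBounds

section PoissonBoundary

variable {lam x : ℝ} {f : ℝ → ℝ}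

lemma continuousOn_poissonFactor (lam : ℝ) : ContinuousOn (poissonFactor lam) (Ioi 0) := by
  unfold poissonFactor
  refine ContinuousOn.div ?_ ?_ fun y (hy : 0 < y) => by positivity
  · exact continuousOn_id.rpow_const fun y (hy : 0 < y) => Or.inl hy.ne'
  · exact ContinuousOn.rpow_const (by fun_prop) fun y (hy : 0 < y) => Or.inl (by positivity)

lemma integrableOn_poissonFactor (hlam : 0 ≤ lam) : IntegrableOn (poissonFactor lam) (Ioi 0) := by
  refine integrable_inv_one_add_sq.integrableOn.mono'
    (measurable_poissonFactor lam).aestronglyMeasurable ?_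
  filter_upwards [ae_restrict_mem measurableSet_Ioi] with y (hy : 0 < y)
  rw [norm_of_nonneg (poissonFactor_pos hy).le, poissonFactor, rpow_add (by positivity), rpow_one,
    ← div_div, add_comm 1, ← one_div]
  gcongr
  rw [div_le_one (by positivity), rpow_mul hy.le, rpow_two]
  gcongr
  linarith

lemma exists_sq_add_one_le_mul_sq_sub (x : ℝ) {δ : ℝ} (hδ : 0 < δ) :
    ∃ K > 0, ∀ y, δ ≤ |y - x| → y ^ 2 + 1 ≤ K * (x - y) ^ 2 := by
  refine ⟨(1 + 2 * x ^ 2) / δ ^ 2 + 2, by positivity, fun y hy => ?_⟩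
  have hδle : δ ^ 2 ≤ (x - y) ^ 2 := by
    rw [← sq_abs (x - y), abs_sub_comm]
    gcongr
  have hone : 1 + 2 * x ^ 2 ≤ (1 + 2 * x ^ 2) / δ ^ 2 * (x - y) ^ 2 := by
    rw [div_mul_eq_mul_div, le_div_iff₀ (by positivity)]
    gcongr
  linarith [sq_nonneg (2 * x - y)]

lemma exists_poissonKernel_mul_rpow_le_poissonFactor (hlam : 0 ≤ lam) (hx : 0 < x) {δ : ℝ}
    (hδ : 0 < δ) :
    ∃ C, ∀ t y, 0 < t → 0 < y → δ ≤ |y - x| →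
      poissonKernel lam t x y * y ^ (2 * lam) ≤ t * C * poissonFactor lam y := by
  have := poissonConst_pos hlam
  obtain ⟨K, hK, hle⟩ := exists_sq_add_one_le_mul_sq_sub x hδ
  refine ⟨poissonConst lam * K ^ (lam + 1), fun t y ht hy hyδ => ?_⟩
  have hxy : x ≠ y := by
    rintro rfl
    rw [sub_self, abs_zero] at hyδ
    exact hδ.not_ge hyδ
  calc poissonKernel lam t x y * y ^ (2 * lam)
      ≤ poissonConst lam * t * ((x - y) ^ 2) ^ (-(lam + 1)) * y ^ (2 * lam) := by
        gcongr
        exact poissonKernel_le hlam ht hx hy hxy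
    _ ≤ poissonConst lam * t * ((y ^ 2 + 1) / K) ^ (-(lam + 1)) * y ^ (2 * lam) := by
        gcongr poissonConst lam * t * ?_ * _
        exact rpow_le_rpow_of_nonpos (by positivity) ((div_le_iff₀' hK).2 (hle y hyδ))
          (by linarith)
    _ = _ := by
        rw [rpow_neg (by positivity), div_rpow (by positivity) hK.le, inv_div, poissonFactor]
        ring

theorem ae_tendsto_poissonIntegral (hlam : 0 ≤ lam)
    (hf : AEMeasurable f (volume.restrict (Ioi (0 : ℝ))))
    (hfin : FiniteAgainst (poissonFactor lam) f) :
    ∀ᵐ x ∂volume.restrict (Ioi (0 : ℝ)),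
      Tendsto (fun t => poissonIntegral lam f t x) (𝓝[>] 0) (𝓝 (f x)) := by
  have hloc : LocallyIntegrableOn f (Ioi 0) :=
    hfin.locallyIntegrableOn (measurable_poissonFactor lam) (continuousOn_poissonFactor lam)
      (fun y hy => poissonFactor_pos hy) hf
  filter_upwards [ae_restrict_isLebesguePoint isOpen_Ioi hloc, ae_restrict_mem measurableSet_Ioi]
    with x hfx (hx : 0 < x)
  obtain ⟨C, hC, hnear⟩ := exists_poissonKernel_mul_rpow_le_cauchy hlam
  have hnorm : ∀ {t y : ℝ}, 0 < t → 0 < y →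
      ‖poissonKernel lam t x y * y ^ (2 * lam)‖ = poissonKernel lam t x y * y ^ (2 * lam) :=
    fun ht hy => norm_of_nonneg
      (mul_nonneg (poissonKernel_pos hlam ht hx hy).le (rpow_nonneg hy.le _))
  have hpos : ∀ᶠ t : ℝ in 𝓝[>] 0, 0 < t := self_mem_nhdsWithin
  suffices Tendsto (fun t => ∫ y in Ioi 0, poissonKernel lam t x y * y ^ (2 * lam) * f y)
      (𝓝[>] 0) (𝓝 (f x)) by simpa only [poissonIntegral, mul_right_comm _ (f _)] using this
  refine tendsto_setIntegral_mul_of_isLebesguePoint (ρ := id) (U := Ioo 0 (2 * x))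
    (φ := poissonFactor lam) measurableSet_Ioi (Ioi_mem_nhds hx)
    (Ioo_mem_nhds hx (by linarith)) hf hfx (integrableOn_poissonFactor hlam)
    (hfin.integrableOn (measurable_poissonFactor lam) (fun y hy => (poissonFactor_pos hy).le) hf)
    ?_ ?_ hC hpos ?_ fun δ hδ => ?_
  · filter_upwards [hpos] with t ht using integral_poissonKernel hlam ht hx
  · filter_upwards [hpos] with t ht
    simpa only [mul_right_comm _ (f _)] using integrableOn_poissonKernel_mul hlam hf hfin ht hx
  · filter_upwards [hpos] with t ht y hy
    rw [hnorm ht hy.1]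
    exact hnear t x y ht hx hy.1 hy.2.le
  · obtain ⟨C, hfar⟩ := exists_poissonKernel_mul_rpow_le_poissonFactor hlam hx hδ
    refine ⟨fun t => t * C, ?_, ?_⟩
    · simpa using (tendsto_nhdsWithin_of_tendsto_nhds (tendsto_id (x := 𝓝 (0 : ℝ)))).mul_const C
    · filter_upwards [hpos] with t ht y hy hyδ
      rw [hnorm ht hy]
      exact hfar t y ht hy hyδ

end PoissonBoundary

section Converse

variable {lam t x : ℝ} {f : ℝ → ℝ}

lemma FiniteAgainst.of_mul_le {φ F : ℝ → ℝ} {c : ℝ} (hc : 0 < c) (hf : ∀ y, 0 < y → 0 ≤ f y)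
    (hle : ∀ y, 0 < y → c * φ y ≤ F y)
    (hfin : ∫⁻ y in Ioi (0 : ℝ), ENNReal.ofReal (F y * f y) < ⊤) : FiniteAgainst φ f := by
  calc ∫⁻ y in Ioi 0, ENNReal.ofReal (φ y * |f y|)
      ≤ ∫⁻ y in Ioi (0 : ℝ), ENNReal.ofReal c⁻¹ * ENNReal.ofReal (F y * f y) := by
        refine setLIntegral_mono' measurableSet_Ioi fun y hy => ?_
        rw [← ENNReal.ofReal_mul (by positivity), abs_of_nonneg (hf y hy), ← mul_assoc]
        exact ENNReal.ofReal_le_ofReal (mul_le_mul_of_nonneg_right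
          ((le_inv_mul_iff₀ hc).2 (hle y hy)) (hf y hy))
    _ = ENNReal.ofReal c⁻¹ * ∫⁻ y in Ioi (0 : ℝ), ENNReal.ofReal (F y * f y) :=
        lintegral_const_mul' _ _ ENNReal.ofReal_ne_top
    _ < ⊤ := ENNReal.mul_lt_top ENNReal.ofReal_lt_top hfin

lemma heatFactor_le {s y : ℝ} (hlam : 0 ≤ lam) (hs : 0 < s) (hst : s ≤ t) (hy : 0 < y) :
    heatFactor lam s y ≤ exp (-y ^ 2 / (4 * t)) * y ^ (2 * lam) := by
  have hdecay : (1 + y) ^ (-lam) ≤ 1 :=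
    rpow_le_one_of_one_le_of_nonpos (by linarith) (by linarith)
  have htime : exp (-y ^ 2 / (4 * s)) ≤ exp (-y ^ 2 / (4 * t)) := by
    rw [exp_le_exp, neg_div, neg_div, neg_le_neg_iff]
    gcongr
  rw [heatFactor_eq hy, mul_comm (exp _)]
  gcongr
  exact mul_le_of_le_one_right (by positivity) hdecay

theorem finiteAgainst_heatFactor_of_lintegral_lt_top (hlam : 0 ≤ lam)
    (hf : ∀ y, 0 < y → 0 ≤ f y) (ht : 0 < t) (hx : 0 < x)
    (hfin : ∫⁻ y in Ioi (0 : ℝ), ENNReal.ofReal (heatKernel lam t x y * f y * y ^ (2 * lam)) < ⊤)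
    {s : ℝ} (hs : 0 < s) (hst : s ≤ t) : FiniteAgainst (heatFactor lam s) f := by
  have hc := heatConst_pos hlam
  simp only [mul_right_comm _ (f _)] at hfin
  refine FiniteAgainst.of_mul_le
    (c := heatConst lam * t ^ (-(lam + 1 / 2)) * exp (-x ^ 2 / (4 * t)))
    (by positivity) hf (fun y hy => ?_) hfin
  calc heatConst lam * t ^ (-(lam + 1 / 2)) * exp (-x ^ 2 / (4 * t)) * heatFactor lam s y
      ≤ heatConst lam * t ^ (-(lam + 1 / 2)) * exp (-x ^ 2 / (4 * t)) *
        (exp (-y ^ 2 / (4 * t)) * y ^ (2 * lam)) := by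
        gcongr
        exact heatFactor_le hlam hs hst hy
    _ = heatConst lam * t ^ (-(lam + 1 / 2)) * exp (-(x ^ 2 + y ^ 2) / (4 * t)) *
        y ^ (2 * lam) := by
        rw [neg_add (x ^ 2), add_div, exp_add]
        ring
    _ ≤ heatKernel lam t x y * y ^ (2 * lam) := by
        gcongr
        exact le_heatKernel hlam ht hx hy

theorem finiteAgainst_poissonFactor_of_lintegral_lt_top (hlam : 0 ≤ lam)
    (hf : ∀ y, 0 < y → 0 ≤ f y) (ht : 0 < t) (hx : 0 < x)
    (hfin : ∫⁻ y in Ioi (0 : ℝ),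
      ENNReal.ofReal (poissonKernel lam t x y * f y * y ^ (2 * lam)) < ⊤) :
    FiniteAgainst (poissonFactor lam) f := by
  have hc := poissonConst_pos hlam
  simp only [mul_right_comm _ (f _)] at hfin
  refine FiniteAgainst.of_mul_le
    (c := poissonConst lam * t * (t ^ 2 + 2 * x ^ 2 + 2) ^ (-(lam + 1)))
    (by positivity) hf (fun y hy => ?_) hfin
  calc poissonConst lam * t * (t ^ 2 + 2 * x ^ 2 + 2) ^ (-(lam + 1)) * poissonFactor lam y
      = poissonConst lam * t * ((t ^ 2 + 2 * x ^ 2 + 2) * (y ^ 2 + 1)) ^ (-(lam + 1)) *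
        y ^ (2 * lam) := by
        rw [mul_rpow (by positivity) (by positivity), rpow_neg (by positivity : 0 ≤ y ^ 2 + 1),
          poissonFactor]
        ring
    _ ≤ poissonKernel lam t x y * y ^ (2 * lam) := by
        gcongr
        exact le_poissonKernel hlam ht hx hy

end Converse

section HeatInterval

variable {lam t x : ℝ} {T : EReal} {f : ℝ → ℝ}

lemma exists_finiteAgainst_heatFactor (ht : 0 ≤ t) (htT : (t : EReal) < T)
    (hfin : ∀ t : ℝ, 0 < t → (t : EReal) < T → FiniteAgainst (heatFactor lam t) f) :
    ∃ t₀, t < t₀ ∧ FiniteAgainst (heatFactor lam t₀) f := by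
  obtain ⟨t₀, htt₀, ht₀T⟩ := EReal.lt_iff_exists_real_btwn.1 htT
  have htt₀ : t < t₀ := EReal.coe_lt_coe_iff.1 htt₀
  exact ⟨t₀, htt₀, hfin t₀ (ht.trans_lt htt₀) ht₀T⟩

theorem contDiffOn_heatIntegral_of_forall_lt (hlam : 0 ≤ lam)
    (hf : AEMeasurable f (volume.restrict (Ioi (0 : ℝ))))
    (hfin : ∀ t : ℝ, 0 < t → (t : EReal) < T → FiniteAgainst (heatFactor lam t) f) :
    ContDiffOn ℝ ∞ (fun p : ℝ × ℝ => heatIntegral lam f p.1 p.2)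
      {p : ℝ × ℝ | 0 < p.1 ∧ (p.1 : EReal) < T ∧ 0 < p.2} := by
  rintro ⟨t, x⟩ ⟨ht, htT, hx⟩
  obtain ⟨t₀, htt₀, hfin₀⟩ := exists_finiteAgainst_heatFactor ht.le htT hfin
  refine ((contDiffOn_heatIntegral hlam hf hfin₀).contDiffAt
    (IsOpen.mem_nhds ?_ ⟨ht, htt₀, hx⟩)).contDiffWithinAt
  exact (isOpen_lt continuous_const continuous_fst).inter
    ((isOpen_lt continuous_fst continuous_const).inter
      (isOpen_lt continuous_const continuous_snd))

end HeatInterval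

end BesselProblem

end

theorem theorem1p1 (lam : ℝ) (hlam : 0 ≤ lam) (T : EReal) (hT : 0 < T)
    (f : ℝ → ℝ) (hf : AEMeasurable f (volume.restrict (Ioi (0 : ℝ)))) :
    -- heat problem, sufficiency
    ((∀ t : ℝ, 0 < t → (t : EReal) < T →
        BesselProblem.FiniteAgainst (BesselProblem.heatFactor lam t) f) →
      (∀ t x : ℝ, 0 < t → (t : EReal) < T → 0 < x →
        IntegrableOn (fun y => BesselProblem.heatKernel lam t x y * f y * y ^ (2 * lam))
          (Ioi (0 : ℝ))) ∧
      ContDiffOn ℝ ∞ (fun p : ℝ × ℝ => BesselProblem.heatIntegral lam f p.1 p.2)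
        {p : ℝ × ℝ | 0 < p.1 ∧ (p.1 : EReal) < T ∧ 0 < p.2} ∧
      (∀ t x : ℝ, 0 < t → (t : EReal) < T → 0 < x →
        deriv (fun s => BesselProblem.heatIntegral lam f s x) t =
          -BesselProblem.besselOp lam (BesselProblem.heatIntegral lam f t) x) ∧
      (∀ᵐ x ∂(volume.restrict (Ioi (0 : ℝ))),
        Tendsto (fun t => BesselProblem.heatIntegral lam f t x) (𝓝[>] 0) (𝓝 (f x)))) ∧
    -- Poisson problem, sufficiency
    (BesselProblem.FiniteAgainst (BesselProblem.poissonFactor lam) f →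
      (∀ t x : ℝ, 0 < t → 0 < x →
        IntegrableOn (fun y => BesselProblem.poissonKernel lam t x y * f y * y ^ (2 * lam))
          (Ioi (0 : ℝ))) ∧
      ContDiffOn ℝ ∞ (fun p : ℝ × ℝ => BesselProblem.poissonIntegral lam f p.1 p.2)
        {p : ℝ × ℝ | 0 < p.1 ∧ 0 < p.2} ∧
      (∀ t x : ℝ, 0 < t → 0 < x →
        iteratedDeriv 2 (fun s => BesselProblem.poissonIntegral lam f s x) t =
          BesselProblem.besselOp lam (BesselProblem.poissonIntegral lam f t) x) ∧
      (∀ᵐ x ∂(volume.restrict (Ioi (0 : ℝ))),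
        Tendsto (fun t => BesselProblem.poissonIntegral lam f t x) (𝓝[>] 0) (𝓝 (f x)))) ∧
    -- necessity, for nonnegative data
    ((∀ y : ℝ, 0 < y → 0 ≤ f y) →
      -- heat: finiteness at one point `(t, x)` gives the condition at all times up to `t`
      (∀ t x : ℝ, 0 < t → (t : EReal) < T → 0 < x →
        (∫⁻ y in Ioi (0 : ℝ),
          ENNReal.ofReal (BesselProblem.heatKernel lam t x y * f y * y ^ (2 * lam))) < ⊤ →
        ∀ s : ℝ, 0 < s → s ≤ t →
          BesselProblem.FiniteAgainst (BesselProblem.heatFactor lam s) f) ∧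
      -- heat: finiteness for each `t ∈ (0, T)` at some `x` gives the condition on `(0, T)`
      ((∀ t : ℝ, 0 < t → (t : EReal) < T → ∃ x : ℝ, 0 < x ∧
          (∫⁻ y in Ioi (0 : ℝ),
            ENNReal.ofReal (BesselProblem.heatKernel lam t x y * f y * y ^ (2 * lam))) < ⊤) →
        ∀ t : ℝ, 0 < t → (t : EReal) < T →
          BesselProblem.FiniteAgainst (BesselProblem.heatFactor lam t) f) ∧
      -- Poisson: finiteness at one point gives the condition
      ((∃ t x : ℝ, 0 < t ∧ 0 < x ∧
          (∫⁻ y in Ioi (0 : ℝ),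
            ENNReal.ofReal (BesselProblem.poissonKernel lam t x y * f y * y ^ (2 * lam))) < ⊤) →
        BesselProblem.FiniteAgainst (BesselProblem.poissonFactor lam) f)) := by
  refine ⟨fun hfin => ⟨fun t x ht htT hx => ?_,
      BesselProblem.contDiffOn_heatIntegral_of_forall_lt hlam hf hfin,
      fun t x ht htT hx => ?_, ?_⟩,
    fun hfin => ⟨fun t x => BesselProblem.integrableOn_poissonKernel_mul hlam hf hfin,
      BesselProblem.contDiffOn_poissonIntegral hlam hf hfin,
      fun t x => BesselProblem.iteratedDeriv_two_poissonIntegral hlam hf hfin,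
      BesselProblem.ae_tendsto_poissonIntegral hlam hf hfin⟩,
    fun hf0 => ⟨fun t x ht _ hx hfin s =>
      BesselProblem.finiteAgainst_heatFactor_of_lintegral_lt_top hlam hf0 ht hx hfin,
      fun hfin t ht htT => ?_, ?_⟩⟩
  · obtain ⟨t₀, htt₀, hfin₀⟩ := BesselProblem.exists_finiteAgainst_heatFactor ht.le htT hfin
    exact BesselProblem.integrableOn_heatKernel_mul hlam hf hfin₀ ht htt₀ hx
  · obtain ⟨t₀, htt₀, hfin₀⟩ := BesselProblem.exists_finiteAgainst_heatFactor ht.le htT hfin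
    exact BesselProblem.deriv_heatIntegral hlam hf hfin₀ ht htt₀ hx
  · obtain ⟨t₀, ht₀, hfin₀⟩ := BesselProblem.exists_finiteAgainst_heatFactor le_rfl hT hfin
    exact BesselProblem.ae_tendsto_heatIntegral hlam hf ht₀ hfin₀
  · obtain ⟨x, hx, hfinx⟩ := hfin t ht htT
    exact BesselProblem.finiteAgainst_heatFactor_of_lintegral_lt_top hlam hf0 ht hx hfinx ht le_rfl
  · rintro ⟨t, x, ht, hx, hfin⟩
    exact BesselProblem.finiteAgainst_poissonFactor_of_lintegral_lt_top hlam hf0 ht hx hfin
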